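/- A word-length function on a group $G$ is a map $L:G\to\mathbb N$ with $L(1)=0$, $L(g^{-1})=L(g)$ and $L(gh)\le L(g)+L(h)$. A map $f$ between sets with weight functions $v,w$ is p-bounded if $w(f(s))\le C(1+v(s))^k$ for some constants $C,k$. Let $C^*(G;\mathbb Q)$ be the complex of inhomogeneous cochains with trivial coefficients and $PC^*(G;\mathbb Q)$ the subcomplex of cochains $f:G^n\to\mathbb Q$ of polynomial growth, $|f(g_1,\dots,g_n)|\le C(1+\sum_i L(g_i))^k$. Put $PH^n(G;\mathbb Q)=H^n(PC^*(G;\mathbb Q))$ and let $PH^n(G;\mathbb Q)\to H^n(G;\mathbb Q)$ be the comparison map induced by the inclusion $PC^*\subset C^*$. Let $(\Gamma_\bullet^+,L_\bullet^+)$ be a type $P$ free simplicial resolution of $G$, that is, an augmented simplicial group with $\Gamma_{-1}=G$ and with a word-length function $L_n$ on every $\Gamma_n$, such that all face and degeneracy maps are p-bounded homomorphisms and: (i) for $n\ge0$, $\Gamma_n$ is free on a basis $X_n$ and $L_n$ is the word-length metric determined by a function $f_n:X_n\to\{1,2,3,\dots\}$ ($L_n(g)$ is the sum of the values of $f_n$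 on the letters of the reduced word of $g$); (ii) the augmentation $\varepsilon:\Gamma_0\to G$ is onto and $L_{-1}(g)=\min\{L_0(x):\varepsilon(x)=g\}$; (iii) the kernel $\Gamma(\varepsilon)_\bullet$ of the augmentation $\Gamma_\bullet\to G$ has a p-bounded simplicial contraction: a point $c\in\Gamma(\varepsilon)_0$ and p-bounded maps of sets $s_{n+1}:\Gamma(\varepsilon)_n\to\Gamma(\varepsilon)_{n+1}$, $n\ge0$, with $\partial_{n+1}s_{n+1}=\mathrm{id}$, $\partial_i s_{n+1}=s_n\partial_i$ for $0\le i\le n$, $n\geq 1$, and $\partial_0s_1\equiv c$. (In particular $\pi_n(\Gamma_\bullet)=0$ for $n>0$ and $\pi_0(\Gamma_\bullet)=G$.) Let $D^*$ be the cocomplex with $D^0=0$ and $D^n=PH^1(\Gamma_{n-1};\mathbb Q)$ for $n\ge1$, with coboundary $D^n\to D^{n+1}$ equal to $\sum_{i=0}^{n}(-1)^i\partial_i^*$, and let $E^*$ be defined in the same way with $H^1$ in place of $PH^1$. Then: (a) The comparison maps $PH^1(\Gamma_{n-1};\mathbb Q)\to H^1(\Gamma_{n-1};\mathbb Q)$ form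 an injective map of cocomplexes $D^*\hookrightarrow E^*$. (b) For every $n\ge1$ there are isomorphisms of $\mathbb Q$-vector spaces $$a_n:PH^n(G;\mathbb Q)\xrightarrow{\ \cong\ }H^n(D^*),\qquad b_n:H^n(G;\mathbb Q)\xrightarrow{\ \cong\ }H^n(E^*)$$ under which the map $H^n(D^*)\to H^n(E^*)$ induced by the inclusion is the comparison map $PH^n(G;\mathbb Q)\to H^n(G;\mathbb Q)$. (c) These isomorphisms are the canonical ones: let $T_P^*$ be the total complex of the bicomplex $PC^p(\Gamma_q;\mathbb Q)$, with differential $\sum_i(-1)^i\partial_i^*+(-1)^q\delta$, where $\delta$ is the cochain differential of $\Gamma_q$. For $n\ge1$ the cochain map $D^*\to T_P^*$ that regards a class in $PH^1(\Gamma_{n-1};\mathbb Q)$ as a $1$-cocycle on $\Gamma_{n-1}$ induces an isomorphism on $H^n$, and its composite with $a_n$ is the map $PH^n(G;\mathbb Q)\to H^n(T_P^*)$ given by pull-back along $\varepsilon$. The same holds for $b_n$, $E^*$ and the bicomplex $C^p(\Gamma_q;\mathbb Q)$. -/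

import Mathlib

open CategoryTheory Opposite Simplicial AlgebraicTopology

noncomputable section

namespace PBd

/-! ### Groups with word-length function -/

/-- A group with an `ℕ`-valued word-length function. -/
structure LenGrp where
  /-- The underlying type. -/
  carrier : Type
  [group : Group carrier]
  /-- The word-length function. -/
  len : carrier → ℕ
  len_one : len 1 = 0
  len_inv : ∀ g, len g⁻¹ = len g
  len_mul_le : ∀ g h, len (g * h) ≤ len g + len h

instance : CoeSort LenGrp Type := ⟨LenGrp.carrier⟩

instance (G : LenGrp) : Group G := G.group

/-- A map of sets `f : S → T` is p-bounded with respect to the weights `v` on `S` and `w` on `T` if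
`w (f s)` is bounded by a polynomial in `v s`. -/
def PolyBounded {S T : Type} (v : S → ℕ) (w : T → ℕ) (f : S → T) : Prop :=
  ∃ C k : ℕ, ∀ s, w (f s) ≤ C * (1 + v s) ^ k

/-- A p-bounded group homomorphism. -/
@[ext]
structure LenGrp.Hom (G H : LenGrp) where
  /-- The underlying homomorphism. -/
  toMonoidHom : G →* H
  polyBounded : PolyBounded G.len H.len toMonoidHom

theorem PolyBounded.comp {S T U : Type} {v : S → ℕ} {w : T → ℕ} {x : U → ℕ} {f : S → T}
    {g : T → U} (hg : PolyBounded w x g) (hf : PolyBounded v w f) : PolyBounded v x (g ∘ f) := by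
  obtain ⟨C, k, hC⟩ := hf
  obtain ⟨D, l, hD⟩ := hg
  refine ⟨D * (1 + C) ^ l, k * l, fun s => (hD (f s)).trans ?_⟩
  rw [pow_mul, mul_assoc, ← mul_pow]
  refine Nat.mul_le_mul_left _ (Nat.pow_le_pow_left ?_ l)
  have h1 : 1 ≤ (1 + v s) ^ k := Nat.one_le_pow _ _ (by omega)
  nlinarith [hC s]

/-- The category of groups with word-length function and p-bounded homomorphisms. A simplicial
object in it is a simplicial group with a word-length function in every degree such that all
face and degeneracy maps are p-bounded. -/
instance : Category LenGrp where
  Hom := LenGrp.Hom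
  id G := ⟨MonoidHom.id G, 1, 1, fun s => by simp⟩
  comp f g := ⟨g.toMonoidHom.comp f.toMonoidHom, g.polyBounded.comp f.polyBounded⟩

/-- The group homomorphism underlying a morphism of `LenGrp`. -/
abbrev homOf {G H : LenGrp} (f : G ⟶ H) : G →* H := LenGrp.Hom.toMonoidHom f

/-! ### Cochains, p-bounded cochains and their cohomology -/

/-- `ℚ` as a trivial representation. -/
abbrev triv (G : LenGrp) : Rep ℚ G := Rep.trivial ℚ G ℚ

/-- The ordinary cochain complex `C^*(G; ℚ)` as a contravariant functor. Its cohomology is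
Mathlib's group cohomology. -/
def cochains : LenGrpᵒᵖ ⥤ CochainComplex (ModuleCat ℚ) ℕ where
  obj G := groupCohomology.inhomogeneousCochains (triv G.unop)
  map {G H} f := groupCohomology.cochainsMap (A := triv G.unop) (B := triv H.unop)
    (homOf f.unop) (𝟙 (triv H.unop))
  map_id _ := rfl
  map_comp _ _ := rfl

/-- The weight `L(g₁) + ⋯ + L(gₙ)` on `Gⁿ`. -/
def tupleLen (G : LenGrp) (n : ℕ) (g : Fin n → G) : ℕ := ∑ i, G.len (g i)

/-- The `n`-cochains of polynomial growth: `|f(g₁, …, gₙ)| ≤ C (1 + L(g₁) + ⋯ + L(gₙ))^k`. They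
correspond to the equivariant homomorphisms from the `n`-th term of the bar resolution to `ℚ` that
are p-bounded on the weighted basis. -/
def polyCochains (G : LenGrp) (n : ℕ) : Submodule ℚ ((Fin n → G) → ℚ) where
  carrier := {f | ∃ C k : ℕ, ∀ g, |f g| ≤ C * (1 + tupleLen G n g : ℚ) ^ k}
  zero_mem' := ⟨0, 0, fun g => by simp⟩
  add_mem' := by
    rintro f f' ⟨C, k, h⟩ ⟨C', k', h'⟩
    refine ⟨C + C', k + k', fun g => (abs_add_le _ _).trans ?_⟩
    have h1 : (1 : ℚ) ≤ 1 + tupleLen G n g := by simp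
    have h2 := pow_le_pow_right₀ h1 (Nat.le_add_right k k')
    have h3 := pow_le_pow_right₀ h1 (Nat.le_add_left k' k)
    push_cast
    rw [add_mul]
    exact add_le_add ((h g).trans (by gcongr)) ((h' g).trans (by gcongr))
  smul_mem' := by
    rintro c f ⟨C, k, h⟩
    refine ⟨⌈|c|⌉₊ * C, k, fun g => ?_⟩
    rw [Pi.smul_apply, smul_eq_mul, abs_mul]
    push_cast
    rw [mul_assoc]
    exact mul_le_mul (Nat.le_ceil _) (h g) (abs_nonneg _) (by positivity)

/-- Pull-back along a p-bounded map preserves polynomial growth. -/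
theorem polyCochains_of_le {G H : LenGrp} {m n : ℕ} {f : (Fin n → H) → ℚ}
    (hf : f ∈ polyCochains H n) (φ : (Fin m → G) → (Fin n → H))
    (hφ : PolyBounded (tupleLen G m) (tupleLen H n) φ) :
    (fun g => f (φ g)) ∈ polyCochains G m := by
  obtain ⟨C, k, h⟩ := hf
  obtain ⟨D, l, h'⟩ := hφ
  refine ⟨C * (1 + D) ^ k, l * k, fun g => (h (φ g)).trans ?_⟩
  have h1 : (1 : ℚ) ≤ (1 + tupleLen G m g : ℚ) ^ l := one_le_pow₀ (by simp)
  have h2 : ((tupleLen H n (φ g) : ℕ) : ℚ) ≤ D * (1 + tupleLen G m g : ℚ) ^ l := by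
    exact_mod_cast h' g
  push_cast
  rw [pow_mul, mul_assoc, ← mul_pow]
  gcongr
  nlinarith

theorem tupleLen_contractNth (G : LenGrp) (n : ℕ) (j : Fin (n + 1)) (g : Fin (n + 1) → G) :
    tupleLen G n (Fin.contractNth j (· * ·) g) ≤ tupleLen G (n + 1) g := by
  have hle : ∀ k : Fin n, G.len (Fin.contractNth j (· * ·) g k) ≤
      G.len (g (j.succAbove k)) + if (k : ℕ) = j then G.len (g j) else 0 := by
    intro k
    rcases lt_trichotomy (k : ℕ) j with h | h | h
    · rw [Fin.contractNth_apply_of_lt _ _ _ _ h, Fin.succAbove_of_castSucc_lt j k h]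
      exact Nat.le_add_right _ _
    · have hj : k.castSucc = j := Fin.ext h
      rw [Fin.contractNth_apply_of_eq _ _ _ _ h, Fin.succAbove_of_le_castSucc j k hj.ge, if_pos h,
        hj, add_comm]
      exact G.len_mul_le _ _
    · rw [Fin.contractNth_apply_of_gt _ _ _ _ h, Fin.succAbove_of_le_castSucc j k h.le]
      exact Nat.le_add_right _ _
  have hsum : ∑ k : Fin n, (if (k : ℕ) = j then G.len (g j) else 0) ≤ G.len (g j) := by
    rw [← Finset.sum_filter, Finset.sum_const, smul_eq_mul]
    refine (Nat.mul_le_mul_right _ (Finset.card_le_one.2 ?_)).trans (one_mul _).le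
    intro a ha b hb
    simp only [Finset.mem_filter, Finset.mem_univ, true_and] at ha hb
    exact Fin.ext (ha.trans hb.symm)
  unfold tupleLen
  rw [Fin.sum_univ_succAbove _ j]
  refine (Finset.sum_le_sum fun k _ => hle k).trans ?_
  rw [Finset.sum_add_distrib]
  omega

theorem d_mem_polyCochains (G : LenGrp) (n : ℕ) {f : (Fin n → G) → ℚ} (hf : f ∈ polyCochains G n) :
    (inhomogeneousCochains.d (triv G) n).hom f ∈ polyCochains G (n + 1) := by
  have key : (inhomogeneousCochains.d (triv G) n).hom f =
      (fun g : Fin (n + 1) → G => f (fun i => g i.succ)) +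
        ∑ j : Fin (n + 1), (-1 : ℚ) ^ ((j : ℕ) + 1) •
          (fun g : Fin (n + 1) → G => f (Fin.contractNth j (· * ·) g)) := by
    funext g
    rw [inhomogeneousCochains.d_hom_apply]
    simp [Finset.sum_apply]
  rw [key]
  refine add_mem (polyCochains_of_le hf _ ⟨1, 1, fun g => ?_⟩)
    (sum_mem fun j _ => Submodule.smul_mem _ _ (polyCochains_of_le hf _ ⟨1, 1, fun g => ?_⟩))
  · have : tupleLen G (n + 1) g = G.len (g 0) + tupleLen G n (fun i => g i.succ) :=
      Fin.sum_univ_succ _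
    simp only [this, pow_one, one_mul]
    omega
  · have := tupleLen_contractNth G n j g
    simp only [pow_one, one_mul]
    omega

/-- The differential of `C^*(G; ℚ)` restricted to cochains of polynomial growth. -/
def polyD (G : LenGrp) (n : ℕ) : polyCochains G n →ₗ[ℚ] polyCochains G (n + 1) :=
  LinearMap.restrict (inhomogeneousCochains.d (triv G) n).hom
    (p := polyCochains G n) (q := polyCochains G (n + 1)) fun _ hf => d_mem_polyCochains G n hf

/-- The subcomplex `PC^*(G; ℚ) ⊆ C^*(G; ℚ)` of cochains of polynomial growth. -/
def polyComplex (G : LenGrp) : CochainComplex (ModuleCat ℚ) ℕ :=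
  CochainComplex.of (fun n => ModuleCat.of ℚ (polyCochains G n))
    (fun n => ModuleCat.ofHom (polyD G n)) fun n => by
      ext f : 2
      apply Subtype.ext
      exact congrArg (fun φ => φ.hom f.1) (groupCohomology.inhomogeneousCochains.d_comp_d
        (A := triv G) n)

/-- The inclusion `PC^*(G; ℚ) ⟶ C^*(G; ℚ)`. -/
def polyIncl (G : LenGrp) :
    polyComplex G ⟶ groupCohomology.inhomogeneousCochains (triv G) :=
  CochainComplex.ofHom (fun n => ModuleCat.ofHom (polyCochains G n).subtype) fun n => by
    simp [polyComplex]
    rfl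

theorem polyBounded_tuple {G H : LenGrp} (f : G ⟶ H) (n : ℕ) :
    PolyBounded (tupleLen G n) (tupleLen H n) fun g => homOf f ∘ g := by
  obtain ⟨C, k, h⟩ := f.polyBounded
  refine ⟨n * C, k, fun g => ?_⟩
  have hi : ∀ i ∈ Finset.univ, H.len ((homOf f ∘ g) i) ≤ C * (1 + tupleLen G n g) ^ k := by
    intro i _
    refine (h (g i)).trans (Nat.mul_le_mul_left _ (Nat.pow_le_pow_left ?_ k))
    exact Nat.add_le_add_left
      (Finset.single_le_sum (f := fun i => G.len (g i)) (fun _ _ => Nat.zero_le _)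
        (Finset.mem_univ i)) 1
  refine (Finset.sum_le_card_nsmul _ _ _ hi).trans ?_
  simp [mul_assoc]

/-- The cochain map on cochains of polynomial growth induced by a p-bounded homomorphism. -/
def polyMap {G H : LenGrp} (f : G ⟶ H) : polyComplex H ⟶ polyComplex G :=
  CochainComplex.ofHom (fun n => ModuleCat.ofHom (LinearMap.restrict
    (LinearMap.funLeft ℚ ℚ fun g : Fin n → G => homOf f ∘ g)
    (p := polyCochains H n) (q := polyCochains G n)
    fun _ hx => polyCochains_of_le hx _ (polyBounded_tuple f n))) fun n => by
    simp only [polyComplex, CochainComplex.of_d]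
    ext x : 2
    apply Subtype.ext
    have := (groupCohomology.cochainsMap (A := triv H) (B := triv G) (homOf f) (𝟙 (triv G))).comm n (n + 1)
    simp only [CochainComplex.of_d] at this
    exact congrArg (fun φ => φ.hom x.1) this

/-- The complex of cochains of polynomial growth as a contravariant functor. -/
def polyCochainsFunctor : LenGrpᵒᵖ ⥤ CochainComplex (ModuleCat ℚ) ℕ where
  obj G := polyComplex G.unop
  map f := polyMap f.unop
  map_id _ := rfl
  map_comp _ _ := rfl

/-- The inclusion of `PC^*(-; ℚ)` into `C^*(-; ℚ)` as a natural transformation. -/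
def polyInclNat : polyCochainsFunctor ⟶ cochains where
  app G := polyIncl G.unop
  naturality _ _ _ := rfl

/-- The `n`-th cohomology functor of a functor of cochains. -/
abbrev coh (F : LenGrpᵒᵖ ⥤ CochainComplex (ModuleCat ℚ) ℕ) (n : ℕ) : LenGrpᵒᵖ ⥤ ModuleCat ℚ :=
  F ⋙ HomologicalComplex.homologyFunctor _ _ n

/-- p-bounded cohomology `PH^n(-; ℚ)` of groups with word-length function. -/
def PH (n : ℕ) : LenGrpᵒᵖ ⥤ ModuleCat ℚ :=
  coh polyCochainsFunctor n

/-- Ordinary group cohomology `H^n(-; ℚ)`; the value at `G` is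
`groupCohomology (Rep.trivial ℚ G ℚ) n`. -/
def H (n : ℕ) : LenGrpᵒᵖ ⥤ ModuleCat ℚ :=
  coh cochains n

theorem H_obj (n : ℕ) (G : LenGrp) :
    (H n).obj (op G) = groupCohomology (Rep.trivial ℚ G ℚ) n := rfl

/-- The comparison map `PH^n(-; ℚ) ⟶ H^n(-; ℚ)`. -/
def comparison (n : ℕ) : PH n ⟶ H n :=
  Functor.whiskerRight polyInclNat (HomologicalComplex.homologyFunctor _ _ n)

/-! ### Type `P` free simplicial resolutions -/

/-- The length function of `G` is a word-length metric: `G` is free on some basis, and the length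
of an element is the sum, over the letters of its reduced word, of positive integers assigned to
the basis elements. -/
def IsFreeWithMetric (G : LenGrp) : Prop :=
  ∃ (S : Type) (b : FreeGroupBasis S G) (f : S → ℕ), (∀ s, 0 < f s) ∧
    ∀ g : G, G.len g =
      ((@FreeGroup.toWord S (Classical.decEq S) (b.repr g)).map fun x => f x.1).sum

/-- The augmentation `ε_n : Γ_n → Γ_{-1}`. -/
def aug (Γ : SimplicialObject.Augmented LenGrp) (n : ℕ) : Γ.left _⦋n⦌ ⟶ Γ.right :=
  Γ.hom.app (op ⦋n⦌)

theorem δ_aug (Γ : SimplicialObject.Augmented LenGrp) (n : ℕ) (i : Fin (n + 2)) :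
    Γ.left.δ i ≫ aug Γ n = aug Γ (n + 1) :=
  (Γ.hom.naturality (SimplexCategory.δ i).op).trans (Category.comp_id _)

/-- `Γ(ε)_n`, the kernel of the augmentation in degree `n`. -/
abbrev augKer (Γ : SimplicialObject.Augmented LenGrp) (n : ℕ) : Subgroup (Γ.left _⦋n⦌) :=
  (homOf (aug Γ n)).ker

/-- The face maps of `Γ(ε)`. -/
def kerFace (Γ : SimplicialObject.Augmented LenGrp) (n : ℕ) (i : Fin (n + 2))
    (x : augKer Γ (n + 1)) : augKer Γ n :=
  ⟨homOf (Γ.left.δ i) x, by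
    have h : homOf (Γ.left.δ i ≫ aug Γ n) (x : Γ.left _⦋n + 1⦌) = 1 := by
      rw [δ_aug]; exact x.2
    exact h⟩

/-- A p-bounded simplicial contraction of `Γ(ε)` as an augmented simplicial set: maps of sets
`s n : Γ(ε)_n → Γ(ε)_{n+1}` and a base point of `Γ(ε)_0` (the value of the contraction in
degree `-1`, where `Γ(ε)_{-1}` is a point), satisfying the identities of an extra last
degeneracy with respect to the face maps and p-bounded in each degree. -/
structure BoundedContraction (Γ : SimplicialObject.Augmented LenGrp) where
  /-- The value of the contraction in degree `-1`. -/
  base : augKer Γ 0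
  /-- The contraction in non-negative degrees. -/
  s : ∀ n, augKer Γ n → augKer Γ (n + 1)
  face_last : ∀ n x, kerFace Γ n (Fin.last (n + 1)) (s n x) = x
  face_zero : ∀ x, kerFace Γ 0 0 (s 0 x) = base
  face_castSucc : ∀ n (i : Fin (n + 2)) x,
    kerFace Γ (n + 1) i.castSucc (s (n + 1) x) = s n (kerFace Γ n i x)
  polyBounded : ∀ n, PolyBounded (fun x : augKer Γ n => (Γ.left _⦋n⦌).len x)
    (fun x : augKer Γ (n + 1) => (Γ.left _⦋n + 1⦌).len x) (s n)

/-- An augmented simplicial group with word-length function is a type `P` free simplicial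
resolution of `Γ_{-1}` if every `Γ_n`, `n ≥ 0`, is free with a word-length metric, the augmentation
is onto and `Γ_{-1}` carries the induced (minimal lift) word-length function, and the kernel of
the augmentation has a p-bounded simplicial contraction. The contraction forces `π_n(Γ) = 0` for
`n > 0` and `π_0(Γ) = Γ_{-1}`. -/
structure IsTypeP (Γ : SimplicialObject.Augmented LenGrp) : Prop where
  metric : ∀ n, IsFreeWithMetric (Γ.left _⦋n⦌)
  induced : ∀ g : Γ.right,
    IsLeast {m | ∃ x : Γ.left _⦋0⦌, homOf (aug Γ 0) x = g ∧ (Γ.left _⦋0⦌).len x = m}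
      (Γ.right.len g)
  contraction : Nonempty (BoundedContraction Γ)

/-! ### The cocomplexes `D^*` and `E^*` -/

theorem altCoface_d {A : Type*} [Category A] [Preadditive A] (Y : CosimplicialObject A) (n : ℕ) :
    ((alternatingCofaceMapComplex A).obj Y).d n (n + 1) =
      AlternatingCofaceMapComplex.objD Y n :=
  CochainComplex.of_d (fun n => Y.obj ⦋n⦌) (AlternatingCofaceMapComplex.objD Y) n

/-- For a contravariant functor `F`, the cocomplex which is `0` in degree `0` and `F(X_{n-1})` in
degree `n ≥ 1`, with coboundary the alternating sum of the maps induced by the face maps. -/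
def shiftedComplex (F : LenGrpᵒᵖ ⥤ ModuleCat ℚ) (X : SimplicialObject LenGrp) :
    CochainComplex (ModuleCat ℚ) ℕ :=
  CochainComplex.augment ((alternatingCofaceMapComplex (ModuleCat ℚ)).obj (X.rightOp ⋙ F))
    (X := ModuleCat.of ℚ PUnit) 0 Limits.zero_comp

/-- The map of cocomplexes induced by a natural transformation. -/
def shiftedMap {F F' : LenGrpᵒᵖ ⥤ ModuleCat ℚ} (τ : F ⟶ F') (X : SimplicialObject LenGrp) :
    shiftedComplex F X ⟶ shiftedComplex F' X where
  f
    | 0 => 𝟙 (ModuleCat.of ℚ PUnit)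
    | n + 1 => ((alternatingCofaceMapComplex (ModuleCat ℚ)).map
        (Functor.whiskerLeft X.rightOp τ)).f n
  comm' i j hij := by
    obtain rfl : i + 1 = j := hij
    cases i with
    | zero =>
      exact (Limits.comp_zero (f := 𝟙 (ModuleCat.of ℚ PUnit))).trans
        (Limits.zero_comp (f := ((alternatingCofaceMapComplex (ModuleCat ℚ)).map
          (Functor.whiskerLeft X.rightOp τ)).f 0)).symm
    | succ n => exact ((alternatingCofaceMapComplex (ModuleCat ℚ)).map
        (Functor.whiskerLeft X.rightOp τ)).comm n (n + 1)

/-- The cocomplex `D^*(Γ; ℚ)`: `D^0 = 0` and `D^n = PH^1(Γ_{n-1}; ℚ)` for `n ≥ 1`. -/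
def D (X : SimplicialObject LenGrp) : CochainComplex (ModuleCat ℚ) ℕ := shiftedComplex (PH 1) X

/-- The cocomplex `E^*(Γ; ℚ)`: `E^0 = 0` and `E^n = H^1(Γ_{n-1}; ℚ)` for `n ≥ 1`. -/
def E (X : SimplicialObject LenGrp) : CochainComplex (ModuleCat ℚ) ℕ := shiftedComplex (H 1) X

/-- The map of cocomplexes `D^*(Γ; ℚ) ⟶ E^*(Γ; ℚ)` given in each degree by the comparison map. -/
def inclDE (X : SimplicialObject LenGrp) : D X ⟶ E X := shiftedMap (comparison 1) X

/-! ### The total complex relating `Γ_{-1}` with the cocomplexes -/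

theorem cochains_d_zero (G : LenGrpᵒᵖ) : (cochains.obj G).d 0 1 = 0 := by
  have h : inhomogeneousCochains.d (triv G.unop) 0 = 0 := by
    apply ModuleCat.hom_ext
    apply LinearMap.ext
    intro f
    funext g
    rw [inhomogeneousCochains.d_hom_apply]
    simp [Subsingleton.elim (Fin.contractNth 0 _ g) fun i : Fin 0 => g i.succ]
    rfl
  exact (groupCohomology.inhomogeneousCochains.d_def (triv G.unop) 0).trans h

theorem polyCochains_d_zero (G : LenGrpᵒᵖ) : (polyCochainsFunctor.obj G).d 0 1 = 0 := by
  have h := (polyIncl G.unop).comm 0 1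
  have h0 : (groupCohomology.inhomogeneousCochains (triv G.unop)).d 0 1 = 0 := cochains_d_zero G
  rw [h0, Limits.comp_zero] at h
  ext f : 2
  apply Subtype.ext
  exact (congrArg (fun φ => φ.hom f) h).symm

/-- The sign conventions for total complexes of first quadrant bicomplexes with cohomological
grading: the differential of the total complex is the horizontal one plus `(-1)^q` times
the vertical one, `q` being the horizontal degree. -/
instance : TotalComplexShape (ComplexShape.up ℕ) (ComplexShape.up ℕ) (ComplexShape.up ℕ) where
  π := fun ⟨q, p⟩ => q + p
  ε₁ := fun _ => 1
  ε₂ := fun ⟨q, _⟩ => (-1) ^ q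
  rel₁ := by
    rintro q _ rfl p
    change q + p + 1 = q + 1 + p
    omega
  rel₂ := by
    rintro q p _ rfl
    rfl
  ε₂_ε₁ := by
    rintro q _ p _ rfl rfl
    simp [pow_succ]

variable (F : LenGrpᵒᵖ ⥤ CochainComplex (ModuleCat ℚ) ℕ)

/-- For a functor `F` of cochains, the bicomplex with `F^p(X_q)` in horizontal degree `q` and
vertical degree `p`; the horizontal differential is the alternating sum of the maps induced by
the face maps, the vertical one is the differential of `F(X_q)`. -/
def bicomplex (X : SimplicialObject LenGrp) :
    HomologicalComplex₂ (ModuleCat ℚ) (ComplexShape.up ℕ) (ComplexShape.up ℕ) :=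
  (alternatingCofaceMapComplex (CochainComplex (ModuleCat ℚ) ℕ)).obj (X.rightOp ⋙ F)

/-- The total complex of the bicomplex. -/
def tot (X : SimplicialObject LenGrp) : CochainComplex (ModuleCat ℚ) ℕ :=
  (bicomplex F X).total (ComplexShape.up ℕ)

theorem bicomplex_d (X : SimplicialObject LenGrp) (q : ℕ) :
    (bicomplex F X).d q (q + 1) = AlternatingCofaceMapComplex.objD (X.rightOp ⋙ F) q :=
  altCoface_d _ q

/-- The inclusion of the summand `F^p(X_q)` of the total complex. -/
def inTot (X : SimplicialObject LenGrp) (q p n : ℕ) (h : q + p = n) :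
    ((bicomplex F X).X q).X p ⟶ (tot F X).X n :=
  (bicomplex F X).ιTotal (ComplexShape.up ℕ) q p n h

theorem inTot_d (X : SimplicialObject LenGrp) (q p n : ℕ) (h : q + p = n) :
    inTot F X q p n h ≫ (tot F X).d n (n + 1) =
      ((bicomplex F X).d q (q + 1)).f p ≫ inTot F X (q + 1) p (n + 1) (by omega) +
        (-1 : ℤˣ) ^ q • (((bicomplex F X).X q).d p (p + 1) ≫
          inTot F X q (p + 1) (n + 1) (by omega)) := by
  unfold inTot tot
  rw [HomologicalComplex₂.total_d, Preadditive.comp_add, HomologicalComplex₂.ι_D₁,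
    HomologicalComplex₂.ι_D₂,
    HomologicalComplex₂.d₁_eq (bicomplex F X) (ComplexShape.up ℕ) (i₁ := q) (i₁' := q + 1) rfl p
      (n + 1) (by change q + 1 + p = n + 1; omega),
    HomologicalComplex₂.d₂_eq (bicomplex F X) (ComplexShape.up ℕ) q (i₂ := p) (i₂' := p + 1) rfl
      (n + 1) (by change q + (p + 1) = n + 1; omega)]
  change (1 : ℤˣ) • _ + _ = _
  rw [one_smul]
  rfl

theorem map_aug_comp (Γ : SimplicialObject.Augmented LenGrp) :
    F.map (aug Γ 0).op ≫ AlternatingCofaceMapComplex.objD (Γ.left.rightOp ⋙ F) 0 = 0 := by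
  have h : ∀ i : Fin 2, F.map (aug Γ 0).op ≫ CosimplicialObject.δ (Γ.left.rightOp ⋙ F) i =
      F.map (aug Γ 1).op := fun i =>
    (F.map_comp (aug Γ 0).op (Γ.left.δ i).op).symm.trans
      (congrArg (fun f => F.map (Quiver.Hom.op f)) (δ_aug Γ 0 i))
  have h2 : AlternatingCofaceMapComplex.objD (Γ.left.rightOp ⋙ F) 0 =
      CosimplicialObject.δ (Γ.left.rightOp ⋙ F) (n := 0) 0 -
        CosimplicialObject.δ (Γ.left.rightOp ⋙ F) (n := 0) 1 := by
    simp [AlternatingCofaceMapComplex.objD, Fin.sum_univ_two, sub_eq_add_neg]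
  rw [h2]
  exact (Preadditive.comp_sub _ _ _).trans (by rw [h, h, sub_self])

/-- Pull-back of cochains along the augmentation `Γ_0 → Γ_{-1}`. -/
def augCochain (Γ : SimplicialObject.Augmented LenGrp) (n : ℕ) :
    (F.obj (op Γ.right)).X n ⟶ ((bicomplex F Γ.left).X 0).X n :=
  (F.map (aug Γ 0).op).f n

/-- Pull-back of cochains along the augmentation, as a cochain map `F(Γ_{-1}) ⟶ Tot`. -/
def augToTot (Γ : SimplicialObject.Augmented LenGrp) :
    F.obj (op Γ.right) ⟶ tot F Γ.left where
  f n := augCochain F Γ n ≫ inTot F Γ.left 0 n n (zero_add n)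
  comm' i j hij := by
    obtain rfl : i + 1 = j := hij
    have h1 : augCochain F Γ i ≫ ((bicomplex F Γ.left).d 0 1).f i = 0 := by
      rw [bicomplex_d]
      exact congrArg (fun φ => HomologicalComplex.Hom.f φ i) (map_aug_comp F Γ)
    have h2 : augCochain F Γ i ≫ ((bicomplex F Γ.left).X 0).d i (i + 1) =
        (F.obj (op Γ.right)).d i (i + 1) ≫ augCochain F Γ (i + 1) :=
      (F.map (aug Γ 0).op).comm i (i + 1)
    rw [Category.assoc, inTot_d, Preadditive.comp_add, reassoc_of% h1, pow_zero, one_smul,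
      reassoc_of% h2, Limits.zero_comp, zero_add]

variable {F}

/-- If the differential `F^0(G) → F^1(G)` vanishes, `H^1(F(G))` is the space of `1`-cocycles;
this is its inclusion into the `1`-cochains. -/
def oneCocycles (hF : ∀ G, (F.obj G).d 0 1 = 0) (G : LenGrpᵒᵖ) :
    (F.obj G).homology 1 ⟶ (F.obj G).X 1 :=
  ((F.obj G).isoHomologyπ 0 1 (by simp) (hF G)).inv ≫ (F.obj G).iCycles 1

theorem oneCocycles_naturality (hF : ∀ G, (F.obj G).d 0 1 = 0) {G K : LenGrpᵒᵖ} (f : G ⟶ K) :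
    HomologicalComplex.homologyMap (F.map f) 1 ≫ oneCocycles hF K =
      oneCocycles hF G ≫ (F.map f).f 1 := by
  rw [oneCocycles, oneCocycles,
    ← cancel_epi ((F.obj G).isoHomologyπ 0 1 (by simp) (hF G)).hom]
  simp

theorem oneCocycles_d (hF : ∀ G, (F.obj G).d 0 1 = 0) (G : LenGrpᵒᵖ) :
    oneCocycles hF G ≫ (F.obj G).d 1 2 = 0 := by
  rw [oneCocycles, Category.assoc, HomologicalComplex.iCycles_d, Limits.comp_zero]

/-- The inclusion of `H^1(F(X_n))` into the `1`-cochains `F^1(X_n)` as the `1`-cocycles. -/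
def oneCochain (hF : ∀ G, (F.obj G).d 0 1 = 0) (X : SimplicialObject LenGrp) (n : ℕ) :
    (shiftedComplex (coh F 1) X).X (n + 1) ⟶ ((bicomplex F X).X n).X 1 :=
  oneCocycles hF (op (X _⦋n⦌))

theorem oneCochain_face (hF : ∀ G, (F.obj G).d 0 1 = 0) (X : SimplicialObject LenGrp) (n : ℕ) :
    oneCochain hF X n ≫ ((bicomplex F X).d n (n + 1)).f 1 =
      (shiftedComplex (coh F 1) X).d (n + 1) (n + 1 + 1) ≫ oneCochain hF X (n + 1) := by
  have h1 : (shiftedComplex (coh F 1) X).d (n + 1) (n + 1 + 1) =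
      AlternatingCofaceMapComplex.objD (X.rightOp ⋙ coh F 1) n := altCoface_d _ n
  have h2 : ((bicomplex F X).d n (n + 1)).f 1 =
      ∑ i : Fin (n + 2), (-1 : ℤ) ^ (i : ℕ) • (F.map (X.δ i).op).f 1 := by
    rw [bicomplex_d]
    exact (map_sum (HomologicalComplex.eval (ModuleCat ℚ) (ComplexShape.up ℕ) 1).mapAddHom _ _).trans
      (Finset.sum_congr rfl fun i _ => map_zsmul _ _ _)
  rw [h1, h2]
  refine (Preadditive.comp_sum _ _ _).trans (Eq.trans ?_ (Preadditive.sum_comp _ _ _).symm)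
  refine Finset.sum_congr rfl fun i _ => ?_
  refine (Preadditive.comp_zsmul _ _ _).trans (Eq.trans ?_ (Preadditive.zsmul_comp _ _ _).symm)
  exact congrArg _ (oneCocycles_naturality hF (X.δ i).op).symm

/-- The cochain map from the cocomplex with `H^1(F(X_{n-1}))` in degree `n` to the total complex
which regards a class in `H^1(F(X_{n-1}))` as a `1`-cocycle, an element of `F^1(X_{n-1})`. -/
def oneToTot (hF : ∀ G, (F.obj G).d 0 1 = 0) (X : SimplicialObject LenGrp) :
    shiftedComplex (coh F 1) X ⟶ tot F X where
  f
    | 0 => (0 : ModuleCat.of ℚ PUnit ⟶ _)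
    | n + 1 => oneCochain hF X n ≫ inTot F X n 1 (n + 1) rfl
  comm' i j hij := by
    obtain rfl : i + 1 = j := hij
    cases i with
    | zero =>
      exact (Limits.zero_comp (X := ModuleCat.of ℚ PUnit)).trans
        (Limits.zero_comp (X := ModuleCat.of ℚ PUnit)).symm
    | succ n =>
      have h : oneCochain hF X n ≫ ((bicomplex F X).X n).d 1 2 = 0 := oneCocycles_d hF _
      change (oneCochain hF X n ≫ inTot F X n 1 (n + 1) rfl) ≫ _ =
        _ ≫ oneCochain hF X (n + 1) ≫ inTot F X (n + 1) 1 (n + 1 + 1) rfl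
      rw [Category.assoc, inTot_d, Preadditive.comp_add, Linear.comp_units_smul, reassoc_of% h,
        Limits.zero_comp, smul_zero, add_zero, ← Category.assoc, oneCochain_face, Category.assoc]

/-- The map `D^* ⟶ Tot(PC^p(X_q; ℚ))` which regards a class in `PH^1` as a p-bounded
homomorphism. -/
def DToTot (X : SimplicialObject LenGrp) : D X ⟶ tot polyCochainsFunctor X :=
  oneToTot polyCochains_d_zero X

/-- The map `E^* ⟶ Tot(C^p(X_q; ℚ))` which regards a class in `H^1` as a homomorphism. -/
def EToTot (X : SimplicialObject LenGrp) : E X ⟶ tot cochains X :=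
  oneToTot cochains_d_zero X

end PBd

end

/-! Let `F` be either cochain functor. The bicomplex `F^p(Γ_q)` receives `F(Γ_{-1})` along its rows
and the complex of `1`-cocycles along its columns. Both maps into the total complex are isomorphisms
on cohomology in positive degrees. Composing the first with the inverse of the second gives `a` and
`b`, and their compatibility with the comparison map is naturality in `F`.

Rows. Every element factors as `x = τ(εx) · r(x)`, where `τ` is a section of minimal length carried
up by degeneracies and `r(x)` lies in the kernel of `ε`. Contracting the second factor turns the
given contraction of the kernel into one of `Γ` onto `Γ_{-1}`
(`IsTypeP.nonempty_augmentedContraction`). It does not consist of homomorphisms, but an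
inhomogeneous `p`-cochain is only a function on `p`-tuples, so it can be pulled back along any map
of sets, and p-boundedness preserves polynomial growth. Hence the rows are exact
(`CochainModel.exactRows`).

Columns. Each `Γ_q` is free, so a cocycle `f` of degree at least two has an explicit primitive,
obtained by summing `f` along the letters of the first argument (`coboundary_freeHomotopy`). Basis
elements have weight at least one, so a word of length `L` has at most `L` letters, each
contributing polynomially much; thus the primitive has polynomial growth when `f` does
(`freeHomotopy_mem_polyCochains`). In degree one there are no nonzero coboundaries, so `H^1` is the
space of `1`-cocycles. The row `p = 0` splits off the total complex because the differential from
degree `0` to `1` vanishes, and it is exact in positive degrees. Only the row of `H^1` remains,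
which is `D` or `E`.

`CochainModel` records what the two functors share, so that each exactness argument is given once.
-/

noncomputable section

namespace PBd

/-! ### Crossed maps on free groups -/

section Crossed

variable {G : Type} [Group G]

/-- The differential of inhomogeneous cochains with trivial rational coefficients. -/
def coboundary (G : Type) [Group G] (n : ℕ) :
    ((Fin n → G) → ℚ) →ₗ[ℚ] ((Fin (n + 1) → G) → ℚ) :=
  (inhomogeneousCochains.d (Rep.trivial ℚ G ℚ) n).hom

theorem coboundary_apply (n : ℕ) (f : (Fin n → G) → ℚ) (g : Fin (n + 1) → G) :
    coboundary G n f g = f (Fin.tail g) +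
      ∑ j : Fin (n + 1), (-1 : ℚ) ^ ((j : ℕ) + 1) * f (Fin.contractNth j (· * ·) g) := by
  refine (inhomogeneousCochains.d_hom_apply _ _ _ _).trans ?_
  simp [Fin.tail_def]

theorem contractNth_zero_cons (n : ℕ) (a b : G) (t : Fin n → G) :
    Fin.contractNth 0 (· * ·) (Fin.cons a (Fin.cons b t) : Fin (n + 2) → G) =
      (Fin.cons (a * b) t : Fin (n + 1) → G) := by
  funext k
  refine Fin.cases ?_ (fun k => ?_) k
  · simp [Fin.contractNth]
  · simp [Fin.contractNth]

theorem contractNth_succ_cons (n : ℕ) (a : G) (j : Fin (n + 1)) (t : Fin (n + 1) → G) :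
    Fin.contractNth j.succ (· * ·) (Fin.cons a t : Fin (n + 2) → G) =
      (Fin.cons a (Fin.contractNth j (· * ·) t) : Fin (n + 1) → G) := by
  funext k
  refine Fin.cases ?_ (fun k => ?_) k
  · simp [Fin.contractNth]
  · simp only [Fin.contractNth, Fin.cons_succ, Fin.val_succ, add_lt_add_iff_right,
      add_left_inj, ← Fin.succ_castSucc]

/-- Currying the first variable in the differential of a cochain. -/
theorem coboundary_cons_cons (n : ℕ) (f : (Fin (n + 1) → G) → ℚ) (a b : G) (t : Fin n → G) :
    coboundary G (n + 1) f (Fin.cons a (Fin.cons b t)) =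
      f (Fin.cons b t) - f (Fin.cons (a * b) t) + f (Fin.cons a t) -
        coboundary G n (fun s => f (Fin.cons a s)) (Fin.cons b t) := by
  rw [coboundary_apply, coboundary_apply, Fin.sum_univ_succ]
  simp only [Fin.tail_cons, contractNth_zero_cons, contractNth_succ_cons, Fin.val_succ,
    Fin.val_zero, pow_succ (-1 : ℚ), pow_zero]
  simp only [mul_neg, mul_one, neg_mul, neg_neg, one_mul, Finset.sum_neg_distrib]
  ring

/-- A map `c : G → (G → ℚ)` with `c (g h) y = c h y + c g (h y)`. -/
def IsCrossed (c : G → G → ℚ) : Prop :=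
  ∀ g h y, c (g * h) y = c h y + c g (h * y)

theorem IsCrossed.one {c : G → G → ℚ} (hc : IsCrossed c) (y : G) : c 1 y = 0 := by
  have := hc 1 1 y
  simpa using this

theorem IsCrossed.inv {c : G → G → ℚ} (hc : IsCrossed c) (g y : G) :
    c g⁻¹ y = -c g (g⁻¹ * y) := by
  have := hc g g⁻¹ y
  rw [mul_inv_cancel, hc.one] at this
  linarith

/-- Uniqueness half of the universal property: the crossed identity propagates values through
products and inverses. It reduces identities between sums over letters to single letters. -/
theorem IsCrossed.eq_of_eq_on_basis {S : Type} (b : FreeGroupBasis S G) {c c' : G → G → ℚ}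
    (hc : IsCrossed c) (hc' : IsCrossed c') (h : ∀ s y, c (b s) y = c' (b s) y) : c = c' := by
  suffices H : ∀ w : FreeGroup S, ∀ y, c (b.repr.symm w) y = c' (b.repr.symm w) y by
    funext g y
    simpa using H (b.repr g) y
  intro w
  have hs : ∀ s, b.repr.symm (FreeGroup.of s) = b s := fun _ => rfl
  induction w using FreeGroup.induction_on with
  | C1 => intro y; rw [map_one, hc.one, hc'.one]
  | of s => intro y; rw [hs, h]
  | inv_of s ih => intro y; rw [map_inv, hc.inv, hc'.inv, ih]
  | mul v w hv hw => intro y; rw [map_mul, hc, hc', hv, hw]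

/-- The permutation `(y, q) ↦ (g y, q + u y)` of `G × ℚ`. -/
def shear (g : G) (u : G → ℚ) : Equiv.Perm (G × ℚ) where
  toFun p := (g * p.1, p.2 + u p.1)
  invFun p := (g⁻¹ * p.1, p.2 - u (g⁻¹ * p.1))
  left_inv p := by simp
  right_inv p := by simp

/-- The crossed map on a free group with prescribed values on the basis. -/
def crossed {S : Type} (b : FreeGroupBasis S G) (ψ : G → G → ℚ) (g y : G) : ℚ :=
  (b.lift (fun s => shear (b s) (ψ (b s))) g (y, 0)).2

/-- Permutations of the form `(y, q) ↦ (g y, q + u y)` are closed under composition and inversion,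
and composing them adds the `u`'s by the crossed rule. Freeness therefore extends arbitrary values
on the basis to a crossed map. -/
theorem lift_shear_apply {S : Type} (b : FreeGroupBasis S G) (ψ : G → G → ℚ) (g : G) :
    ∀ (y : G) (q : ℚ), b.lift (fun s => shear (b s) (ψ (b s))) g (y, q) =
      (g * y, q + crossed b ψ g y) := by
  suffices H : ∀ w : FreeGroup S, ∀ (y : G) (q : ℚ),
      b.lift (fun s => shear (b s) (ψ (b s))) (b.repr.symm w) (y, q) =
        (b.repr.symm w * y, q + crossed b ψ (b.repr.symm w) y) by
    simpa using H (b.repr g)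
  have hs : ∀ s, b.repr.symm (FreeGroup.of s) = b s := fun _ => rfl
  have hof : ∀ s, b.lift (fun s => shear (b s) (ψ (b s))) (b s) = shear (b s) (ψ (b s)) :=
    fun s => by simp
  intro w
  induction w using FreeGroup.induction_on with
  | C1 => simp [crossed]
  | of s =>
    intro y q
    rw [hs, crossed, hof]
    simp [shear]
  | inv_of s _ =>
    intro y q
    rw [map_inv, crossed, hs, map_inv, hof]
    simp [shear, Equiv.Perm.inv_def, sub_eq_add_neg]
  | mul v w hv hw =>
    intro y q
    rw [map_mul, crossed, map_mul, Equiv.Perm.mul_apply, Equiv.Perm.mul_apply, hw, hv, hw, hv]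
    simp [mul_assoc, add_assoc]

theorem isCrossed_crossed {S : Type} (b : FreeGroupBasis S G) (ψ : G → G → ℚ) :
    IsCrossed (crossed b ψ) := by
  intro g h y
  have h1 := lift_shear_apply b ψ (g * h) y 0
  rw [map_mul, Equiv.Perm.mul_apply, lift_shear_apply, lift_shear_apply] at h1
  have := congrArg Prod.snd h1
  simpa using this.symm

theorem crossed_basis {S : Type} (b : FreeGroupBasis S G) (ψ : G → G → ℚ) (s : S) (y : G) :
    crossed b ψ (b s) y = ψ (b s) y := by
  simp [crossed, shear]

/-- For an `(m + 2)`-cochain `f`, the `(m + 1)`-cochain which sums `f` along the letters of the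
first argument. -/
def subdivide {S : Type} (b : FreeGroupBasis S G) {m : ℕ} (f : (Fin (m + 2) → G) → ℚ)
    (g : Fin (m + 1) → G) : ℚ :=
  crossed b (fun x y => f (Fin.cons x (Fin.cons y (Fin.tail g)))) (g 0) 1

/-- The homotopy which exhibits cocycles of degree at least two on a free group as coboundaries. -/
def freeHomotopy {S : Type} (b : FreeGroupBasis S G) {m : ℕ} (f : (Fin (m + 2) → G) → ℚ)
    (g : Fin (m + 1) → G) : ℚ :=
  f (Fin.cons 1 g) - subdivide b f g

/-- Summing along letters gives a cochain whose coboundary is `-f` up to the term `f(1, d, t)`,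
which need not vanish since cochains are not normalized. The summand `f(1, ·)` of the homotopy has
exactly that term as its coboundary and cancels it. -/
theorem coboundary_freeHomotopy {S : Type} (b : FreeGroupBasis S G) {m : ℕ}
    (f : (Fin (m + 2) → G) → ℚ) (hf : coboundary G (m + 2) f = 0) :
    coboundary G (m + 1) (freeHomotopy b f) = f := by
  have hf1 : ∀ a b t, f (Fin.cons b t) - f (Fin.cons (a * b) t) + f (Fin.cons a t) -
      coboundary G (m + 1) (fun s => f (Fin.cons a s)) (Fin.cons b t) = 0 := fun a b t => by
    rw [← coboundary_cons_cons, hf]; rfl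
  have hsplit : freeHomotopy b f = (fun g => f (Fin.cons 1 g)) - subdivide b f := rfl
  rw [hsplit, map_sub]
  funext g
  obtain ⟨a, g, rfl⟩ : ∃ a g', g = Fin.cons a g' := ⟨g 0, Fin.tail g, (Fin.cons_self_tail g).symm⟩
  obtain ⟨d, t, rfl⟩ : ∃ a g', g = Fin.cons a g' := ⟨g 0, Fin.tail g, (Fin.cons_self_tail g).symm⟩
  -- The cocycle identity with first argument `1` computes the coboundary of `f(1, ·)` as `f(1, d,
  -- t)`.
  have hv := hf1 1 a (Fin.cons d t)
  rw [one_mul] at hv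
  set P : (Fin m → G) → G → G → ℚ := fun t => crossed b fun x y => f (Fin.cons x (Fin.cons y t))
    with hP
  have hPc : ∀ t, IsCrossed (P t) := fun t => isCrossed_crossed b _
  have hPb : ∀ t s y, P t (b s) y = f (Fin.cons (b s) (Fin.cons y t)) :=
    fun t s y => crossed_basis b _ s y
  have hU : ∀ x (t : Fin m → G), subdivide b f (Fin.cons x t) = P t x 1 := fun x t => by
    simp [subdivide, hP]
  -- Both sides are crossed in `(g, y)`: on the left because the coboundary is linear, on the right
  -- because `f(g y, ·) - f(y, ·)` is a principal crossed map and right translation by `d` commutes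
  -- with the action. For `g` in the basis this is the cocycle condition with the first two
  -- variables curried.
  have key : (fun g y => coboundary G m (fun s => P s g y) (Fin.cons d t)) =
      fun g y => f (Fin.cons (g * y) (Fin.cons d t)) - f (Fin.cons y (Fin.cons d t)) -
        P t g (y * d) + P t g y := by
    refine IsCrossed.eq_of_eq_on_basis b ?_ ?_ ?_
    · intro g h y
      have : (fun s => P s (g * h) y) = (fun s => P s h y) + fun s => P s g (h * y) :=
        funext fun s => hPc s g h y
      simp only [this, map_add]
      rfl
    · intro g h y
      simp only [hPc t g h, mul_assoc]
      ring
    · intro s y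
      simp only [hPb]
      have h1 := hf1 (b s) y (Fin.cons d t)
      rw [coboundary_cons_cons] at h1
      linarith
  have key' := congrFun (congrFun key a) 1
  simp only [mul_one, one_mul] at key'
  have h2 := coboundary_cons_cons m (subdivide b f) a d t
  simp only [hU] at h2
  rw [key', hPc t a d 1, mul_one] at h2
  rw [Pi.sub_apply, h2]
  linarith

end Crossed

/-! ### Growth of the homotopy for a word-length metric -/

/-- The value at a word is a sum of one term per letter, evaluated at the product of the letters to
its right. The length bound in the first conjunct controls that product, and the bound `B` stays
fixed along the induction so that every letter receives the same estimate. The number `T` stands for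
the length of the remaining arguments. -/
theorem abs_crossed_mk_le (G : LenGrp) {S : Type} (b : FreeGroupBasis S G) (l : S → ℕ)
    (hl : ∀ s, G.len (b s) ≤ l s) (ψ : G → G → ℚ) (C k T : ℕ)
    (hψ : ∀ x y, |ψ x y| ≤ C * (1 + (G.len x + (G.len y + T)) : ℚ) ^ k) (w : List (S × Bool)) :
    G.len (b.repr.symm (FreeGroup.mk w)) ≤ (w.map fun x => l x.1).sum ∧
      ∀ B : ℕ, 2 * (w.map fun x => l x.1).sum ≤ B →
      |crossed b ψ (b.repr.symm (FreeGroup.mk w)) 1| ≤ w.length * (C * (1 + (B + T) : ℚ) ^ k) := by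
  induction w with
  | nil =>
    refine ⟨?_, fun B _ => ?_⟩
    · change G.len (b.repr.symm 1) ≤ _
      rw [map_one, G.len_one]
      exact Nat.zero_le _
    · change |crossed b ψ (b.repr.symm 1) 1| ≤ _
      rw [map_one, (isCrossed_crossed b ψ).one]
      simp
  | cons x w ih =>
    obtain ⟨s, ε⟩ := x
    have hs : ∀ s, b.repr.symm (FreeGroup.of s) = b s := fun _ => rfl
    have hmk : b.repr.symm (FreeGroup.mk ((s, ε) :: w)) =
        b.repr.symm (FreeGroup.mk [(s, ε)]) * b.repr.symm (FreeGroup.mk w) := by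
      rw [← map_mul]; rfl
    -- An inverse letter evaluates `ψ` at `(s, s⁻¹ y)`, so the weight of `s` is counted twice; hence
    -- the factor `2`.
    have hx : G.len (b.repr.symm (FreeGroup.mk [(s, ε)])) ≤ l s ∧ ∀ (y : G) (B : ℕ),
        2 * l s + G.len y ≤ B →
        |crossed b ψ (b.repr.symm (FreeGroup.mk [(s, ε)])) y| ≤ C * (1 + (B + T) : ℚ) ^ k := by
      have hB : ∀ x y : G, ∀ B : ℕ, G.len x + G.len y ≤ B →
          |ψ x y| ≤ C * (1 + (B + T) : ℚ) ^ k := fun x y B h => by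
        refine (hψ x y).trans ?_
        have : (G.len x + G.len y : ℚ) ≤ B := by exact_mod_cast h
        refine mul_le_mul_of_nonneg_left (pow_le_pow_left₀ (by positivity) ?_ k) (by positivity)
        linarith
      cases ε with
      | true =>
        change G.len (b s) ≤ _ ∧ ∀ (y : G) (B : ℕ), _ → |crossed b ψ (b s) y| ≤ _
        refine ⟨hl s, fun y B h => ?_⟩
        rw [crossed_basis]
        exact hB _ _ _ (by have := hl s; omega)
      | false =>
        change G.len (b.repr.symm (FreeGroup.of s)⁻¹) ≤ _ ∧ ∀ (y : G) (B : ℕ), _ →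
          |crossed b ψ (b.repr.symm (FreeGroup.of s)⁻¹) y| ≤ _
        rw [map_inv, hs, G.len_inv]
        refine ⟨hl s, fun y B h => ?_⟩
        rw [(isCrossed_crossed b ψ).inv, crossed_basis, abs_neg]
        refine hB _ _ _ ?_
        have h1 := G.len_mul_le (b s)⁻¹ y
        rw [G.len_inv] at h1
        have := hl s
        omega
    rw [hmk]
    simp only [List.map_cons, List.sum_cons, List.length_cons]
    refine ⟨(G.len_mul_le _ _).trans (add_le_add hx.1 ih.1), fun B h => ?_⟩
    rw [isCrossed_crossed b ψ, mul_one]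
    refine (abs_add_le _ _).trans ?_
    push_cast
    rw [add_mul, one_mul]
    exact add_le_add (ih.2 B (by omega)) (hx.2 _ B (by have := ih.1; omega))

theorem tupleLen_cons (G : LenGrp) (n : ℕ) (x : G) (t : Fin n → G) :
    tupleLen G (n + 1) (Fin.cons x t) = G.len x + tupleLen G n t := by
  simp [tupleLen, Fin.sum_univ_succ]

theorem length_le_sum_map {S : Type} (l : S → ℕ) (hl : ∀ s, 0 < l s) (w : List (S × Bool)) :
    w.length ≤ (w.map fun x => l x.1).sum := by
  induction w with
  | nil => simp
  | cons x w ih =>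
    have := hl x.1
    simp only [List.map_cons, List.sum_cons, List.length_cons]
    omega

theorem freeHomotopy_mem_polyCochains (G : LenGrp) {S : Type} (b : FreeGroupBasis S G) (l : S → ℕ)
    (hl : ∀ s, 0 < l s)
    (hlen : ∀ g : G, G.len g =
      ((@FreeGroup.toWord S (Classical.decEq S) (b.repr g)).map fun x => l x.1).sum)
    {m : ℕ} {f : (Fin (m + 2) → G) → ℚ} (hf : f ∈ polyCochains G (m + 2)) :
    freeHomotopy b f ∈ polyCochains G (m + 1) := by
  classical
  have hb : ∀ s, G.len (b s) ≤ l s := fun s => by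
    rw [hlen, FreeGroupBasis.repr_apply_coe, FreeGroup.toWord_of]
    simp
  refine sub_mem (polyCochains_of_le hf _ ⟨1, 1, fun g => ?_⟩) ?_
  · rw [tupleLen_cons, G.len_one, pow_one]
    omega
  · obtain ⟨C, k, hC⟩ := hf
    -- The extra degree pays for the number of letters; the factor `2 ^ k` comes from taking `B = 2
    -- L(g₀)`.
    refine ⟨C * 2 ^ k, k + 1, fun g => ?_⟩
    have h := (abs_crossed_mk_le G b l hb
      (fun x y => f (Fin.cons x (Fin.cons y (Fin.tail g)))) C k (tupleLen G m (Fin.tail g))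
      (fun x y => by simpa [tupleLen_cons] using hC (Fin.cons x (Fin.cons y (Fin.tail g))))
      (@FreeGroup.toWord S (Classical.decEq S) (b.repr (g 0)))).2 (2 * G.len (g 0))
      (by rw [← hlen])
    rw [FreeGroup.mk_toWord, MulEquiv.symm_apply_apply] at h
    refine h.trans ?_
    have hT : tupleLen G (m + 1) g = G.len (g 0) + tupleLen G m (Fin.tail g) := by
      rw [← tupleLen_cons, Fin.cons_self_tail]
    have h1 : ((@FreeGroup.toWord S (Classical.decEq S) (b.repr (g 0))).length : ℚ) ≤
        1 + tupleLen G (m + 1) g := by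
      -- Positivity of the weights enters here: without it the number of letters would not be
      -- bounded by the length.
      have h2 := length_le_sum_map l hl (@FreeGroup.toWord S (Classical.decEq S) (b.repr (g 0)))
      rw [← hlen] at h2
      have h3 : (@FreeGroup.toWord S (Classical.decEq S) (b.repr (g 0))).length ≤
        1 + tupleLen G (m + 1) g := by omega
      exact_mod_cast h3
    have h4 : (1 + (((2 * G.len (g 0) : ℕ) : ℚ) + tupleLen G m (Fin.tail g)) : ℚ) ≤
        2 * (1 + tupleLen G (m + 1) g) := by
      have h5 : 1 + (2 * G.len (g 0) + tupleLen G m (Fin.tail g)) ≤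
        2 * (1 + tupleLen G (m + 1) g) := by omega
      exact_mod_cast h5
    calc _ ≤ (1 + tupleLen G (m + 1) g : ℚ) * (C * (2 * (1 + tupleLen G (m + 1) g)) ^ k) := by
          gcongr
      _ = _ := by
          push_cast
          rw [mul_pow]
          ring

/-! ### Homology isomorphisms in terms of elements -/

section Homology

variable {ι : Type} {c : ComplexShape ι}

/-- The space of boundaries in degree `n`. -/
def boundaries (K : HomologicalComplex (ModuleCat.{0} ℚ) c) (n : ι) : Submodule ℚ (K.X n) :=
  LinearMap.range (K.d (c.prev n) n).hom

theorem d_mem_boundaries (K : HomologicalComplex (ModuleCat.{0} ℚ) c) (m n : ι) (w : K.X m) :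
    (K.d m n).hom w ∈ boundaries K n := by
  by_cases h : c.Rel m n
  · obtain rfl := c.prev_eq' h
    exact ⟨w, rfl⟩
  · rw [K.shape _ _ h]
    exact zero_mem _

theorem mem_boundaries_iff (K : HomologicalComplex (ModuleCat.{0} ℚ) c) {m n : ι} (h : c.Rel m n)
    {z : K.X n} : z ∈ boundaries K n ↔ ∃ w, (K.d m n).hom w = z := by
  obtain rfl := c.prev_eq' h
  exact Iff.rfl

theorem d_comp_d_apply (K : HomologicalComplex (ModuleCat.{0} ℚ) c) (i j k : ι) (w : K.X i) :
    (K.d j k).hom ((K.d i j).hom w) = 0 :=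
  congrArg (fun φ => φ.hom w) (K.d_comp_d i j k)

theorem d_eq_zero_of_mem_boundaries {K : HomologicalComplex (ModuleCat.{0} ℚ) c} {n : ι} (k : ι)
    {z : K.X n} (hz : z ∈ boundaries K n) : (K.d n k).hom z = 0 := by
  obtain ⟨w, rfl⟩ := hz
  exact d_comp_d_apply K _ _ _ w

theorem hom_comm_apply {K L : HomologicalComplex (ModuleCat.{0} ℚ) c} (f : K ⟶ L) (i j : ι)
    (x : K.X i) : (L.d i j).hom ((f.f i).hom x) = (f.f j).hom ((K.d i j).hom x) :=
  congrArg (fun φ => φ.hom x) (f.comm i j)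

theorem exists_cycle (K : HomologicalComplex (ModuleCat.{0} ℚ) c) (n k : ι) (hk : c.next n = k)
    (z : K.X n) (hz : (K.d n k).hom z = 0) : ∃ y : K.cycles n, (K.iCycles n).hom y = z := by
  have h := (ShortComplex.mk _ _ (K.iCycles_d n k)).exact_of_f_is_kernel (K.cyclesIsKernel n k hk)
  exact (ShortComplex.moduleCat_exact_iff _).1 h z hz

theorem iCycles_injective (K : HomologicalComplex (ModuleCat.{0} ℚ) c) (n : ι) :
    Function.Injective (K.iCycles n).hom :=
  (ModuleCat.mono_iff_injective _).1 inferInstance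

theorem homologyπ_eq_zero_iff (K : HomologicalComplex (ModuleCat.{0} ℚ) c) (n : ι)
    (y : K.cycles n) :
    (K.homologyπ n).hom y = 0 ↔ (K.iCycles n).hom y ∈ boundaries K n := by
  have hi : ∀ w, (K.iCycles n).hom ((K.toCycles (c.prev n) n).hom w) =
      (K.d (c.prev n) n).hom w := fun w =>
    congrArg (fun φ => φ.hom w) (K.toCycles_i (c.prev n) n)
  constructor
  · intro h
    have h1 := (ShortComplex.mk _ _ (K.toCycles_comp_homologyπ (c.prev n) n)).exact_of_g_is_cokernel
      (K.homologyIsCokernel (c.prev n) n rfl)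
    obtain ⟨w, hw⟩ := (ShortComplex.moduleCat_exact_iff _).1 h1 y h
    exact ⟨w, by rw [← hi]; exact congrArg _ hw⟩
  · rintro ⟨w, hw⟩
    rw [← hi] at hw
    rw [← iCycles_injective K n hw]
    exact congrArg (fun φ => φ.hom w) (K.toCycles_comp_homologyπ (c.prev n) n)

/-- Surjectivity and injectivity on cycles modulo boundaries give epi and mono; the zigzags in the
total complex can then be carried out on elements. -/
theorem isIso_homologyMap {K L : HomologicalComplex (ModuleCat.{0} ℚ) c} (f : K ⟶ L) (n k : ι)
    (hk : c.next n = k)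
    (hsurj : ∀ z : L.X n, (L.d n k).hom z = 0 →
      ∃ x : K.X n, (K.d n k).hom x = 0 ∧ z - (f.f n).hom x ∈ boundaries L n)
    (hinj : ∀ x : K.X n, (K.d n k).hom x = 0 → (f.f n).hom x ∈ boundaries L n →
      x ∈ boundaries K n) : IsIso (HomologicalComplex.homologyMap f n) := by
  have hπ : ∀ y, (HomologicalComplex.homologyMap f n).hom ((K.homologyπ n).hom y) =
      (L.homologyπ n).hom ((HomologicalComplex.cyclesMap f n).hom y) := fun y =>
    congrArg (fun φ => φ.hom y) (HomologicalComplex.homologyπ_naturality f n)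
  have hi : ∀ y, (L.iCycles n).hom ((HomologicalComplex.cyclesMap f n).hom y) =
      (f.f n).hom ((K.iCycles n).hom y) := fun y =>
    congrArg (fun φ => φ.hom y) (HomologicalComplex.cyclesMap_i f n)
  have hd : ∀ (M : HomologicalComplex (ModuleCat.{0} ℚ) c) (y : M.cycles n),
      (M.d n k).hom ((M.iCycles n).hom y) = 0 := fun M y =>
    congrArg (fun φ => φ.hom y) (M.iCycles_d n k)
  have hK : Function.Surjective (K.homologyπ n).hom :=
    (ModuleCat.epi_iff_surjective _).1 inferInstance
  have hL : Function.Surjective (L.homologyπ n).hom :=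
    (ModuleCat.epi_iff_surjective _).1 inferInstance
  have : Mono (HomologicalComplex.homologyMap f n) := by
    refine (ModuleCat.mono_iff_injective _).2 ((injective_iff_map_eq_zero _).2 fun x hx => ?_)
    obtain ⟨y, rfl⟩ := hK x
    rw [homologyπ_eq_zero_iff]
    refine hinj _ (hd K y) ?_
    rw [← hi, ← homologyπ_eq_zero_iff, ← hπ]
    exact hx
  have : Epi (HomologicalComplex.homologyMap f n) := by
    refine (ModuleCat.epi_iff_surjective _).2 fun x => ?_
    obtain ⟨z, rfl⟩ := hL x
    obtain ⟨x, hx, hzx⟩ := hsurj _ (hd L z)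
    obtain ⟨y, rfl⟩ := exists_cycle K n k hk x hx
    refine ⟨(K.homologyπ n).hom y, ?_⟩
    refine (hπ y).trans (sub_eq_zero.1 ?_).symm
    rw [← map_sub, homologyπ_eq_zero_iff, map_sub, hi]
    exact hzx
  exact isIso_of_mono_of_epi _

end Homology

/-! ### Components in the total complex -/

section Total

variable (F : LenGrpᵒᵖ ⥤ CochainComplex (ModuleCat.{0} ℚ) ℕ) (X : SimplicialObject LenGrp)

/-- The projection of the total complex onto the summand `F^p(X_q)`. -/
def prTot (q p n : ℕ) (h : q + p = n) : (tot F X).X n ⟶ ((bicomplex F X).X q).X p :=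
  (bicomplex F X).totalDesc (c₁₂ := ComplexShape.up ℕ) fun q' p' h' =>
    if e : q' = q then eqToHom (by
      have h'' : q' + p' = n := h'
      obtain rfl : p' = p := by omega
      rw [e])
    else 0

theorem inTot_prTot_self (q p n : ℕ) (h : q + p = n) :
    inTot F X q p n h ≫ prTot F X q p n h = 𝟙 _ := by
  refine (HomologicalComplex₂.ι_totalDesc _ _ _ _ _).trans ?_
  simp

theorem inTot_prTot_of_ne (q p q' p' n : ℕ) (h : q + p = n) (h' : q' + p' = n) (hq : q ≠ q') :
    inTot F X q p n h ≫ prTot F X q' p' n h' = 0 := by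
  refine (HomologicalComplex₂.ι_totalDesc _ _ _ _ _).trans ?_
  rw [dif_neg hq]

theorem tot_hom_ext {A : ModuleCat ℚ} {n : ℕ} {f g : (tot F X).X n ⟶ A}
    (h : ∀ q p hqp, inTot F X q p n hqp ≫ f = inTot F X q p n hqp ≫ g) : f = g :=
  HomologicalComplex₂.total.hom_ext (h := fun q p hqp => h q p hqp)

theorem sum_prTot_inTot (n : ℕ) :
    ∑ q : Fin (n + 1), prTot F X q (n - q) n (by omega) ≫ inTot F X q (n - q) n (by omega) =
      𝟙 _ := by
  refine tot_hom_ext F X fun q p hqp => ?_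
  obtain rfl : p = n - q := by omega
  rw [Preadditive.comp_sum, Finset.sum_eq_single (⟨q, by omega⟩ : Fin (n + 1))]
  · rw [← Category.assoc, inTot_prTot_self, Category.id_comp, Category.comp_id]
  · intro b _ hb
    rw [← Category.assoc, inTot_prTot_of_ne, Limits.zero_comp]
    rintro rfl
    exact hb rfl
  · simp

theorem d_prTot (q p n : ℕ) (h : q + 1 + p = n) :
    (tot F X).d n (n + 1) ≫ prTot F X (q + 1) (p + 1) (n + 1) (by omega) =
      prTot F X q (p + 1) n (by omega) ≫ ((bicomplex F X).d q (q + 1)).f (p + 1) +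
        (-1 : ℤˣ) ^ (q + 1) • (prTot F X (q + 1) p n h ≫
          ((bicomplex F X).X (q + 1)).d p (p + 1)) := by
  refine tot_hom_ext F X fun q' p' hqp => ?_
  rw [← Category.assoc, inTot_d, Preadditive.add_comp, Preadditive.comp_add,
    Linear.units_smul_comp, Linear.comp_units_smul]
  simp only [Category.assoc]
  congr 1
  · by_cases hq : q' = q
    · subst hq
      obtain rfl : p' = p + 1 := by omega
      rw [inTot_prTot_self, Category.comp_id, ← Category.assoc, inTot_prTot_self, Category.id_comp]
    · rw [inTot_prTot_of_ne _ _ _ _ _ _ _ _ _ (by omega), Limits.comp_zero, ← Category.assoc,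
        inTot_prTot_of_ne _ _ _ _ _ _ _ _ _ hq, Limits.zero_comp]
  · by_cases hq : q' = q + 1
    · subst hq
      obtain rfl : p' = p := by omega
      rw [inTot_prTot_self, Category.comp_id, ← Category.assoc, inTot_prTot_self, Category.id_comp]
    · rw [inTot_prTot_of_ne _ _ _ _ _ _ _ _ _ hq, Limits.comp_zero, ← Category.assoc,
        inTot_prTot_of_ne _ _ _ _ _ _ _ _ _ hq, Limits.zero_comp, smul_zero, smul_zero]

theorem d_prTot_zero_left (n : ℕ) :
    (tot F X).d n (n + 1) ≫ prTot F X 0 (n + 1) (n + 1) (by omega) =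
      prTot F X 0 n n (by omega) ≫ ((bicomplex F X).X 0).d n (n + 1) := by
  refine tot_hom_ext F X fun q' p' hqp => ?_
  rw [← Category.assoc, inTot_d, Preadditive.add_comp, Linear.units_smul_comp]
  simp only [Category.assoc]
  rw [inTot_prTot_of_ne _ _ _ _ _ _ _ _ _ (by omega), Limits.comp_zero, zero_add]
  by_cases hq : q' = 0
  · subst hq
    obtain rfl : p' = n := by omega
    rw [inTot_prTot_self, Category.comp_id, ← Category.assoc, inTot_prTot_self, Category.id_comp,
      pow_zero, one_smul]
  · rw [inTot_prTot_of_ne _ _ _ _ _ _ _ _ _ hq, Limits.comp_zero, ← Category.assoc,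
      inTot_prTot_of_ne _ _ _ _ _ _ _ _ _ hq, Limits.zero_comp, smul_zero]

theorem d_prTot_zero_right (n : ℕ) :
    (tot F X).d n (n + 1) ≫ prTot F X (n + 1) 0 (n + 1) (by omega) =
      prTot F X n 0 n (by omega) ≫ ((bicomplex F X).d n (n + 1)).f 0 := by
  refine tot_hom_ext F X fun q' p' hqp => ?_
  rw [← Category.assoc, inTot_d, Preadditive.add_comp, Linear.units_smul_comp]
  simp only [Category.assoc]
  rw [inTot_prTot_of_ne _ _ q' (p' + 1) _ _ _ _ _ (by omega), Limits.comp_zero, smul_zero, add_zero]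
  by_cases hq : q' = n
  · subst hq
    obtain rfl : p' = 0 := by omega
    rw [inTot_prTot_self, Category.comp_id, ← Category.assoc, inTot_prTot_self, Category.id_comp]
  · rw [inTot_prTot_of_ne _ _ _ _ _ _ _ _ _ (by omega), Limits.comp_zero, ← Category.assoc,
      inTot_prTot_of_ne _ _ _ _ _ _ _ _ _ hq, Limits.zero_comp]

variable {F X}

theorem prTot_inTot_apply_self {q p n : ℕ} (h : q + p = n) (x : ((bicomplex F X).X q).X p) :
    (prTot F X q p n h).hom ((inTot F X q p n h).hom x) = x :=
  congrArg (fun φ => φ.hom x) (inTot_prTot_self F X q p n h)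

theorem prTot_inTot_apply_of_ne {q p q' p' n : ℕ} (h : q + p = n) (h' : q' + p' = n) (hq : q ≠ q')
    (x : ((bicomplex F X).X q).X p) :
    (prTot F X q' p' n h').hom ((inTot F X q p n h).hom x) = 0 :=
  congrArg (fun φ => φ.hom x) (inTot_prTot_of_ne F X q p q' p' n h h' hq)

theorem tot_ext {n : ℕ} {y z : (tot F X).X n}
    (h : ∀ q p hqp, (prTot F X q p n hqp).hom y = (prTot F X q p n hqp).hom z) : y = z := by
  have key : ∀ y : (tot F X).X n, ∑ q : Fin (n + 1), (inTot F X q (n - q) n (by omega)).hom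
      ((prTot F X q (n - q) n (by omega)).hom y) = y := fun y => by
    have := congrArg (fun φ => φ.hom y) (sum_prTot_inTot F X n)
    simpa using this
  rw [← key y, ← key z]
  exact Finset.sum_congr rfl fun q _ => by rw [h]

theorem d_inTot_apply {q p n : ℕ} (h : q + p = n) (x : ((bicomplex F X).X q).X p) :
    ((tot F X).d n (n + 1)).hom ((inTot F X q p n h).hom x) =
      (inTot F X (q + 1) p (n + 1) (by omega)).hom ((((bicomplex F X).d q (q + 1)).f p).hom x) +
        (-1 : ℤˣ) ^ q • (inTot F X q (p + 1) (n + 1) (by omega)).hom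
          ((((bicomplex F X).X q).d p (p + 1)).hom x) :=
  congrArg (fun φ => φ.hom x) (inTot_d F X q p n h)

theorem prTot_d_apply {q p n : ℕ} (h : q + 1 + p = n) (y : (tot F X).X n) :
    (prTot F X (q + 1) (p + 1) (n + 1) (by omega)).hom (((tot F X).d n (n + 1)).hom y) =
      (((bicomplex F X).d q (q + 1)).f (p + 1)).hom
          ((prTot F X q (p + 1) n (by omega)).hom y) +
        (-1 : ℤˣ) ^ (q + 1) • (((bicomplex F X).X (q + 1)).d p (p + 1)).hom
          ((prTot F X (q + 1) p n h).hom y) :=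
  congrArg (fun φ => φ.hom y) (d_prTot F X q p n h)

theorem prTot_d_apply_zero_left {n : ℕ} (y : (tot F X).X n) :
    (prTot F X 0 (n + 1) (n + 1) (by omega)).hom (((tot F X).d n (n + 1)).hom y) =
      (((bicomplex F X).X 0).d n (n + 1)).hom ((prTot F X 0 n n (by omega)).hom y) :=
  congrArg (fun φ => φ.hom y) (d_prTot_zero_left F X n)

theorem prTot_d_apply_zero_right {n : ℕ} (y : (tot F X).X n) :
    (prTot F X (n + 1) 0 (n + 1) (by omega)).hom (((tot F X).d n (n + 1)).hom y) =
      (((bicomplex F X).d n (n + 1)).f 0).hom ((prTot F X n 0 n (by omega)).hom y) :=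
  congrArg (fun φ => φ.hom y) (d_prTot_zero_right F X n)

/-- If `y` vanishes in horizontal degree `q + 1`, the component of its coboundary in horizontal
degree `q + 1` is the horizontal differential of its component in horizontal degree `q`. -/
theorem prTot_d_of_right_eq_zero {q p n : ℕ} (h : q + p = n) (y : (tot F X).X n)
    (hy : ∀ p' h', (prTot F X (q + 1) p' n h').hom y = 0) :
    (prTot F X (q + 1) p (n + 1) (by omega)).hom (((tot F X).d n (n + 1)).hom y) =
      (((bicomplex F X).d q (q + 1)).f p).hom ((prTot F X q p n h).hom y) := by
  cases p with
  | zero =>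
    obtain rfl : q = n := h
    exact prTot_d_apply_zero_right y
  | succ p => rw [prTot_d_apply (by omega), hy, map_zero, smul_zero, add_zero]

/-- If `y` vanishes in vertical degree `p + 1`, the component of its coboundary in vertical
degree `p + 1` is, up to sign, the vertical differential of its component in vertical degree `p`. -/
theorem prTot_d_of_up_eq_zero {q p n : ℕ} (h : q + p = n) (y : (tot F X).X n)
    (hy : ∀ q' h', (prTot F X q' (p + 1) n h').hom y = 0) :
    (prTot F X q (p + 1) (n + 1) (by omega)).hom (((tot F X).d n (n + 1)).hom y) =
      (-1 : ℤˣ) ^ q • (((bicomplex F X).X q).d p (p + 1)).hom ((prTot F X q p n h).hom y) := by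
  cases q with
  | zero =>
    obtain rfl : p = n := by omega
    rw [prTot_d_apply_zero_left, pow_zero, one_smul]
  | succ q => rw [prTot_d_apply h, hy, map_zero, zero_add]

end Total

/-! ### Bicomplexes with exact rows -/

section Rows

variable {F : LenGrpᵒᵖ ⥤ CochainComplex (ModuleCat.{0} ℚ) ℕ} {Γ : SimplicialObject.Augmented LenGrp}

variable (F Γ) in
/-- Exactness of the rows of the bicomplex augmented by the cochains of `Γ_{-1}`. -/
structure ExactRows : Prop where
  injective : ∀ p, Function.Injective (augCochain F Γ p).hom
  exact_zero : ∀ p (x : ((bicomplex F Γ.left).X 0).X p),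
    (((bicomplex F Γ.left).d 0 1).f p).hom x = 0 → ∃ c, (augCochain F Γ p).hom c = x
  exact_succ : ∀ q p (x : ((bicomplex F Γ.left).X (q + 1)).X p),
    (((bicomplex F Γ.left).d (q + 1) (q + 2)).f p).hom x = 0 →
      ∃ y, (((bicomplex F Γ.left).d q (q + 1)).f p).hom y = x

theorem augToTot_f_apply (n : ℕ) (c : (F.obj (op Γ.right)).X n) :
    ((augToTot F Γ).f n).hom c =
      (inTot F Γ.left 0 n n (zero_add n)).hom ((augCochain F Γ n).hom c) := rfl

/-- Staircase argument: the component of largest horizontal degree is closed in its row, hence a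
horizontal coboundary, and subtracting a total coboundary moves the support one column to the left.
Only the components of `dy` in positive horizontal degree must vanish, so the statement applies both
to cocycles and to `y` whose coboundary is pulled back from `Γ_{-1}`. -/
theorem ExactRows.exists_eq_add (hr : ExactRows F Γ) {m : ℕ} (k : ℕ) :
    ∀ y : (tot F Γ.left).X m,
      (∀ q p h, k ≤ q → (prTot F Γ.left q p m h).hom y = 0) →
      (∀ q p h, (prTot F Γ.left (q + 1) p (m + 1) h).hom
        (((tot F Γ.left).d m (m + 1)).hom y) = 0) →
      ∃ c, y - ((augToTot F Γ).f m).hom c ∈ boundaries (tot F Γ.left) m := by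
  induction k with
  | zero =>
    intro y hy _
    obtain rfl : y = 0 := tot_ext fun q p h => by rw [hy q p h (Nat.zero_le _), map_zero]
    exact ⟨0, by simp⟩
  | succ k ih =>
    intro y hy hdy
    by_cases hk : k ≤ m
    swap
    -- For `k > m` there is no component in horizontal degree `k`.
    · exact ih y (fun q p h hq => absurd h (by omega)) hdy
    have h1 : (((bicomplex F Γ.left).d k (k + 1)).f (m - k)).hom
        ((prTot F Γ.left k (m - k) m (by omega)).hom y) = 0 := by
      rw [← prTot_d_of_right_eq_zero (by omega) y fun p' h' => hy _ _ _ le_rfl]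
      exact hdy _ _ _
    cases k with
    | zero =>
      obtain ⟨c, hc⟩ := hr.exact_zero m _ h1
      refine ⟨c, ?_⟩
      rw [augToTot_f_apply, hc]
      suffices h0 : y = (inTot F Γ.left 0 m m (zero_add m)).hom
          ((prTot F Γ.left 0 m m (zero_add m)).hom y) by
        change y - (inTot F Γ.left 0 m m (zero_add m)).hom
          ((prTot F Γ.left 0 m m (zero_add m)).hom y) ∈ _
        rw [sub_eq_zero.2 h0]
        exact zero_mem _
      refine tot_ext fun q p h => ?_
      cases q with
      | zero =>
        obtain rfl : p = m := by omega
        exact (prTot_inTot_apply_self _ _).symm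
      | succ q => rw [hy _ _ _ (by omega), prTot_inTot_apply_of_ne _ _ (by omega)]
    | succ k =>
      obtain ⟨w, hw⟩ := hr.exact_succ k _ _ h1
      obtain ⟨m, rfl⟩ : ∃ m', m = m' + 1 := ⟨m - 1, by omega⟩
      have hkm : k + (m + 1 - (k + 1)) = m := by omega
      set v := ((tot F Γ.left).d m (m + 1)).hom ((inTot F Γ.left k _ m hkm).hom w) with hv
      have hsupp : ∀ q p h, k + 1 ≤ q → (prTot F Γ.left q p (m + 1) h).hom (y - v) = 0 := by
        intro q p h hq
        have hmul : ∀ (u : ℤˣ) (x : (tot F Γ.left).X (m + 1)),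
            (prTot F Γ.left q p (m + 1) h).hom (u • x) =
              u • (prTot F Γ.left q p (m + 1) h).hom x := fun u x => by
          rw [Units.smul_def, Units.smul_def, map_zsmul]
        rw [map_sub, hv, d_inTot_apply, hw, map_add, hmul,
          prTot_inTot_apply_of_ne (q := k) (q' := q) _ _ (by omega), smul_zero, add_zero]
        rcases eq_or_lt_of_le hq with rfl | hq
        · obtain rfl : p = m + 1 - (k + 1) := by omega
          rw [prTot_inTot_apply_self, sub_self]
        · rw [prTot_inTot_apply_of_ne _ _ (by omega), sub_zero]
          exact hy _ _ _ hq
      obtain ⟨c, hc⟩ := ih (y - v) hsupp fun q p h => by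
        rw [map_sub, hv, d_comp_d_apply, sub_zero, hdy]
      refine ⟨c, ?_⟩
      have := add_mem hc (d_mem_boundaries _ m (m + 1) ((inTot F Γ.left k _ m hkm).hom w))
      rw [← hv] at this
      convert this using 1
      abel

theorem ExactRows.augToTot_injective (hr : ExactRows F Γ) (n : ℕ) :
    Function.Injective ((augToTot F Γ).f n).hom := by
  intro x y hxy
  refine hr.injective n ?_
  have := congrArg (prTot F Γ.left 0 n n (zero_add n)).hom hxy
  simpa only [augToTot_f_apply, prTot_inTot_apply_self] using this

theorem ExactRows.isIso_homologyMap_augToTot (hr : ExactRows F Γ) (n : ℕ) :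
    IsIso (HomologicalComplex.homologyMap (augToTot F Γ) n) := by
  refine isIso_homologyMap _ n (n + 1) (by simp) (fun z hz => ?_) fun x hx hb => ?_
  · obtain ⟨c, hc⟩ := hr.exists_eq_add (n + 1) z (fun q p h hq => absurd h (by omega))
      fun q p h => by rw [hz, map_zero]
    refine ⟨c, hr.augToTot_injective (n + 1) ?_, hc⟩
    have h1 := d_eq_zero_of_mem_boundaries (n + 1) hc
    rw [map_sub, hz, zero_sub, neg_eq_zero, hom_comm_apply] at h1
    rw [h1, map_zero]
  · cases n with
    | zero =>
      obtain ⟨y, hy⟩ := hb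
      -- No index precedes `0`, so the only boundary in degree `0` is zero.
      rw [HomologicalComplex.shape _ _ _ (by simp)] at hy
      obtain rfl : x = 0 := hr.augToTot_injective 0 (by rw [← hy, map_zero]; rfl)
      exact zero_mem _
    | succ n =>
      have hrel : (ComplexShape.up ℕ).Rel n (n + 1) := rfl
      obtain ⟨y, hy⟩ := (mem_boundaries_iff _ hrel).1 hb
      rw [mem_boundaries_iff _ hrel]
      obtain ⟨c, hc⟩ := hr.exists_eq_add (n + 1) y (fun q p h hq => absurd h (by omega))
        fun q p h => by
          rw [hy, augToTot_f_apply, prTot_inTot_apply_of_ne _ _ (by omega)]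
      refine ⟨c, hr.augToTot_injective _ ?_⟩
      have h1 := d_eq_zero_of_mem_boundaries (n + 1) hc
      rw [map_sub, hy, hom_comm_apply, sub_eq_zero] at h1
      exact h1.symm

end Rows

/-! ### Bicomplexes whose columns are exact above degree one -/

section Columns

variable {F : LenGrpᵒᵖ ⥤ CochainComplex (ModuleCat.{0} ℚ) ℕ} {X : SimplicialObject LenGrp}

theorem oneCochain_injective (hF : ∀ G, (F.obj G).d 0 1 = 0) (X : SimplicialObject LenGrp)
    (q : ℕ) : Function.Injective (oneCochain hF X q).hom := by
  have : Mono (oneCocycles hF (op (X _⦋q⦌))) := by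
    unfold oneCocycles
    infer_instance
  exact (ModuleCat.mono_iff_injective (oneCocycles hF (op (X _⦋q⦌)))).1 this

theorem exists_oneCochain_eq (hF : ∀ G, (F.obj G).d 0 1 = 0) (q : ℕ)
    (x : ((bicomplex F X).X q).X 1) (hx : (((bicomplex F X).X q).d 1 2).hom x = 0) :
    ∃ e, (oneCochain hF X q).hom e = x := by
  obtain ⟨y, hy⟩ := exists_cycle (F.obj (op (X _⦋q⦌))) 1 2 (by simp) x hx
  refine ⟨((F.obj (op (X _⦋q⦌))).isoHomologyπ 0 1 (by simp) (hF _)).hom.hom y, ?_⟩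
  refine Eq.trans ?_ hy
  exact congrArg (fun φ => φ.hom y) (Iso.hom_inv_id_assoc
    ((F.obj (op (X _⦋q⦌))).isoHomologyπ 0 1 (by simp) (hF _)) ((F.obj (op (X _⦋q⦌))).iCycles 1))

variable (F X) in
/-- Exactness of the columns of the bicomplex above degree one, and of the bottom row in positive
degrees. -/
structure ExactColumns : Prop where
  exact : ∀ q p (x : ((bicomplex F X).X q).X (p + 2)),
    (((bicomplex F X).X q).d (p + 2) (p + 3)).hom x = 0 →
      ∃ y, (((bicomplex F X).X q).d (p + 1) (p + 2)).hom y = x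
  exact_bottom : ∀ q (x : ((bicomplex F X).X (q + 1)).X 0),
    (((bicomplex F X).d (q + 1) (q + 2)).f 0).hom x = 0 →
      ∃ y, (((bicomplex F X).d q (q + 1)).f 0).hom y = x

theorem oneToTot_f_apply (hF : ∀ G, (F.obj G).d 0 1 = 0) (n : ℕ)
    (e : (shiftedComplex (coh F 1) X).X (n + 1)) :
    ((oneToTot hF X).f (n + 1)).hom e =
      (inTot F X n 1 (n + 1) rfl).hom ((oneCochain hF X n).hom e) := rfl

theorem prTot_units_smul {q p n : ℕ} (h : q + p = n) (u : ℤˣ) (x : (tot F X).X n) :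
    (prTot F X q p n h).hom (u • x) = u • (prTot F X q p n h).hom x := by
  rw [Units.smul_def, Units.smul_def, map_zsmul]

/-- The transposed staircase: exact columns push the support down until only vertical degrees `1`
and `0` are left. The vertical degree `1` component is then a `1`-cocycle, giving `e`, and the rest
lies in the bottom row, giving `c`. -/
theorem ExactColumns.exists_eq_add (hc : ExactColumns F X) (hF : ∀ G, (F.obj G).d 0 1 = 0) {m : ℕ}
    (k : ℕ) : ∀ y : (tot F X).X m,
      (∀ q p h, k ≤ p → (prTot F X q p m h).hom y = 0) →
      (∀ q p h, (prTot F X q (p + 2) (m + 1) h).hom (((tot F X).d m (m + 1)).hom y) = 0) →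
      ∃ e c, y - ((oneToTot hF X).f m).hom e - (inTot F X m 0 m rfl).hom c ∈
        boundaries (tot F X) m := by
  induction k with
  | zero =>
    intro y hy _
    obtain rfl : y = 0 := tot_ext fun q p h => by rw [hy q p h (Nat.zero_le _), map_zero]
    exact ⟨0, 0, by simp⟩
  | succ k ih =>
    intro y hy hdy
    by_cases hk : k ≤ m
    swap
    · exact ih y (fun q p h hq => absurd h (by omega)) hdy
    match k, hk with
    | 0, _ =>
      refine ⟨0, (prTot F X m 0 m rfl).hom y, ?_⟩
      suffices h0 : y = (inTot F X m 0 m rfl).hom ((prTot F X m 0 m rfl).hom y) by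
        rw [map_zero, sub_zero, sub_eq_zero.2 h0]
        exact zero_mem _
      refine tot_ext fun q p h => ?_
      cases p with
      | zero =>
        obtain rfl : q = m := h
        exact (prTot_inTot_apply_self _ _).symm
      | succ p => rw [hy _ _ _ (by omega), prTot_inTot_apply_of_ne _ _ (by omega)]
    | 1, hk =>
      obtain ⟨m, rfl⟩ : ∃ m', m = m' + 1 := ⟨m - 1, by omega⟩
      have h1 : (((bicomplex F X).X m).d 1 2).hom ((prTot F X m 1 (m + 1) rfl).hom y) = 0 := by
        have h2 := prTot_d_of_up_eq_zero (q := m) (p := 1) rfl y fun q' h' => hy _ _ _ le_rfl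
        rw [hdy m 0 rfl] at h2
        exact (smul_eq_zero_iff_eq _).1 h2.symm
      obtain ⟨e, he⟩ := exists_oneCochain_eq hF m _ h1
      have hsupp : ∀ q p h, 1 ≤ p →
          (prTot F X q p (m + 1) h).hom (y - ((oneToTot hF X).f (m + 1)).hom e) = 0 := by
        intro q p h hp
        rw [map_sub, oneToTot_f_apply, he]
        rcases eq_or_lt_of_le hp with rfl | hp
        · obtain rfl : q = m := by omega
          rw [prTot_inTot_apply_self, sub_self]
        · rw [prTot_inTot_apply_of_ne _ _ (by omega), sub_zero]
          exact hy _ _ _ hp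
      obtain ⟨e', c, hec⟩ := ih _ hsupp fun q p h => by
        rw [map_sub, map_sub, hdy, hom_comm_apply, oneToTot_f_apply, zero_sub, neg_eq_zero,
          prTot_inTot_apply_of_ne _ _ (by omega)]
      refine ⟨e + e', c, ?_⟩
      convert hec using 1
      rw [map_add]
      abel
    | k + 2, hk =>
      obtain ⟨m, rfl⟩ : ∃ m', m = m' + 1 := ⟨m - 1, by omega⟩
      obtain ⟨q₀, hq₀⟩ : ∃ q₀, q₀ + (k + 2) = m + 1 := ⟨m + 1 - (k + 2), by omega⟩
      have h1 : (((bicomplex F X).X q₀).d (k + 2) (k + 3)).hom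
          ((prTot F X q₀ (k + 2) (m + 1) hq₀).hom y) = 0 := by
        have h2 := prTot_d_of_up_eq_zero hq₀ y fun q' h' => hy _ _ _ le_rfl
        rw [hdy q₀ (k + 1) (by omega)] at h2
        exact (smul_eq_zero_iff_eq _).1 h2.symm
      obtain ⟨w, hw⟩ := hc.exact _ _ _ h1
      have hkm : q₀ + (k + 1) = m := by omega
      -- The sign cancels the one that the total differential puts on the vertical part in column
      -- `q₀`.
      set v := ((tot F X).d m (m + 1)).hom ((-1 : ℤˣ) ^ q₀ • (inTot F X q₀ _ m hkm).hom w) with hv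
      have hv' : v = (-1 : ℤˣ) ^ q₀ • (inTot F X (q₀ + 1) (k + 1) (m + 1) (by omega)).hom
          ((((bicomplex F X).d q₀ (q₀ + 1)).f (k + 1)).hom w) +
          (inTot F X q₀ (k + 2) (m + 1) hq₀).hom
            ((prTot F X q₀ (k + 2) (m + 1) hq₀).hom y) := by
        have hu : (-1 : ℤˣ) ^ q₀ * (-1 : ℤˣ) ^ q₀ = 1 := by
          rw [← mul_pow]; simp
        rw [hv, Units.smul_def, map_zsmul, ← Units.smul_def, d_inTot_apply, smul_add, smul_smul,
          hu, one_smul, hw]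
      have hsupp : ∀ q p h, k + 2 ≤ p → (prTot F X q p (m + 1) h).hom (y - v) = 0 := by
        intro q p h hp
        rw [map_sub, hv', map_add, prTot_units_smul,
          prTot_inTot_apply_of_ne (q := q₀ + 1) (q' := q) _ _ (by omega), smul_zero, zero_add]
        rcases eq_or_lt_of_le hp with rfl | hp
        · obtain rfl : q = q₀ := by omega
          rw [prTot_inTot_apply_self, sub_self]
        · rw [prTot_inTot_apply_of_ne _ _ (by omega), sub_zero]
          exact hy _ _ _ hp
      obtain ⟨e, c, hec⟩ := ih (y - v) hsupp fun q p h => by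
        rw [map_sub, hv, d_comp_d_apply, sub_zero, hdy]
      refine ⟨e, c, ?_⟩
      have := add_mem hec (d_mem_boundaries _ m (m + 1)
        ((-1 : ℤˣ) ^ q₀ • (inTot F X q₀ _ m hkm).hom w))
      rw [← hv] at this
      convert this using 1
      abel

theorem d_inTot_bottom_apply (hF : ∀ G, (F.obj G).d 0 1 = 0) (n : ℕ)
    (c : ((bicomplex F X).X n).X 0) :
    ((tot F X).d n (n + 1)).hom ((inTot F X n 0 n rfl).hom c) =
      (inTot F X (n + 1) 0 (n + 1) rfl).hom ((((bicomplex F X).d n (n + 1)).f 0).hom c) := by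
  have h0 : (((bicomplex F X).X n).d 0 1).hom c = 0 := congrArg (fun φ => φ.hom c) (hF _)
  rw [d_inTot_apply]
  erw [h0]
  rw [map_zero, smul_zero, add_zero]

theorem prTot_oneToTot_inTot (hF : ∀ G, (F.obj G).d 0 1 = 0) (n : ℕ)
    (e : (shiftedComplex (coh F 1) X).X (n + 1)) (c : ((bicomplex F X).X (n + 1)).X 0) :
    (prTot F X n 1 (n + 1) rfl).hom (((oneToTot hF X).f (n + 1)).hom e +
        (inTot F X (n + 1) 0 (n + 1) rfl).hom c) = (oneCochain hF X n).hom e ∧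
      (prTot F X (n + 1) 0 (n + 1) rfl).hom (((oneToTot hF X).f (n + 1)).hom e +
        (inTot F X (n + 1) 0 (n + 1) rfl).hom c) = c := by
  rw [map_add, map_add, oneToTot_f_apply, prTot_inTot_apply_self, prTot_inTot_apply_self,
    prTot_inTot_apply_of_ne _ _ (by omega), prTot_inTot_apply_of_ne _ _ (by omega), add_zero,
    zero_add]
  exact ⟨rfl, rfl⟩

/-- The contributions of the `1`-cocycles and of the bottom row lie in different bidegrees, also
after applying the differential, so each can be compared separately. In positive degree the bottom
row part is a coboundary. In degree `0` it need not be, whence the shift `n + 1`. -/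
theorem ExactColumns.isIso_homologyMap_oneToTot (hc : ExactColumns F X)
    (hF : ∀ G, (F.obj G).d 0 1 = 0) (n : ℕ) :
    IsIso (HomologicalComplex.homologyMap (oneToTot hF X) (n + 1)) := by
  refine isIso_homologyMap _ (n + 1) (n + 2) (by simp) (fun z hz => ?_) fun x hx hb => ?_
  · obtain ⟨e, c, hec⟩ := hc.exists_eq_add hF (n + 2) z (fun q p h hq => absurd h (by omega))
      fun q p h => by rw [hz, map_zero]
    have h1 := d_eq_zero_of_mem_boundaries (n + 2) hec
    rw [map_sub, map_sub, hz, zero_sub, hom_comm_apply, d_inTot_bottom_apply hF, ← neg_add',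
      neg_eq_zero] at h1
    have h2 := prTot_oneToTot_inTot hF (n + 1)
      (((shiftedComplex (coh F 1) X).d (n + 1) (n + 2)).hom e)
      ((((bicomplex F X).d (n + 1) (n + 2)).f 0).hom c)
    erw [h1] at h2
    rw [map_zero, map_zero] at h2
    obtain ⟨w, hw⟩ := hc.exact_bottom n c h2.2.symm
    refine ⟨e, oneCochain_injective hF X _ (by rw [map_zero]; exact h2.1.symm), ?_⟩
    have h3 := d_mem_boundaries (tot F X) n (n + 1) ((inTot F X n 0 n rfl).hom w)
    rw [d_inTot_bottom_apply hF, hw] at h3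
    convert add_mem hec h3 using 1
    abel
  · have hrel : (ComplexShape.up ℕ).Rel n (n + 1) := rfl
    obtain ⟨y, hy⟩ := (mem_boundaries_iff _ hrel).1 hb
    rw [mem_boundaries_iff _ hrel]
    obtain ⟨e, c, hec⟩ := hc.exists_eq_add hF (n + 1) y (fun q p h hq => absurd h (by omega))
      fun q p h => by
        rw [hy, oneToTot_f_apply, prTot_inTot_apply_of_ne _ _ (by omega)]
    have h1 := d_eq_zero_of_mem_boundaries (n + 1) hec
    rw [map_sub, map_sub, hy, hom_comm_apply, d_inTot_bottom_apply hF, sub_sub,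
      sub_eq_zero] at h1
    refine ⟨e, oneCochain_injective hF X n ?_⟩
    rw [← (prTot_oneToTot_inTot hF n _ _).1, ← h1, oneToTot_f_apply, prTot_inTot_apply_self]

end Columns

/-! ### Naturality -/

section Naturality

variable {F F' : LenGrpᵒᵖ ⥤ CochainComplex (ModuleCat.{0} ℚ) ℕ} (τ : F ⟶ F')

/-- The map of total complexes induced by a natural transformation. -/
def totMap (X : SimplicialObject LenGrp) : tot F X ⟶ tot F' X :=
  HomologicalComplex₂.total.map ((alternatingCofaceMapComplex
    (CochainComplex (ModuleCat ℚ) ℕ)).map (Functor.whiskerLeft X.rightOp τ)) (ComplexShape.up ℕ)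

/-- The component of `totMap` on the summand `F^p(X_q)`. -/
def totMapApp (X : SimplicialObject LenGrp) (q p : ℕ) :
    ((bicomplex F X).X q).X p ⟶ ((bicomplex F' X).X q).X p :=
  (τ.app (op (X _⦋q⦌))).f p

theorem inTot_totMap (X : SimplicialObject LenGrp) (q p n : ℕ) (h : q + p = n) :
    inTot F X q p n h ≫ (totMap τ X).f n = totMapApp τ X q p ≫ inTot F' X q p n h :=
  HomologicalComplex₂.ιTotal_map _ _ _ _ _ _ _ _

theorem augToTot_totMap (Γ : SimplicialObject.Augmented LenGrp) :
    augToTot F Γ ≫ totMap τ Γ.left = τ.app (op Γ.right) ≫ augToTot F' Γ := by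
  ext n : 1
  have h : augCochain F Γ n ≫ totMapApp τ Γ.left 0 n =
      (τ.app (op Γ.right)).f n ≫ augCochain F' Γ n :=
    congrArg (fun φ => HomologicalComplex.Hom.f φ n) (τ.naturality (aug Γ 0).op)
  change (augCochain F Γ n ≫ inTot F Γ.left 0 n n _) ≫ (totMap τ Γ.left).f n =
    (τ.app (op Γ.right)).f n ≫ augCochain F' Γ n ≫ inTot F' Γ.left 0 n n _
  rw [Category.assoc, inTot_totMap, ← Category.assoc, h, Category.assoc]

theorem homologyMap_oneCocycles (hF : ∀ G, (F.obj G).d 0 1 = 0) (hF' : ∀ G, (F'.obj G).d 0 1 = 0)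
    (G : LenGrpᵒᵖ) :
    HomologicalComplex.homologyMap (τ.app G) 1 ≫ oneCocycles hF' G =
      oneCocycles hF G ≫ (τ.app G).f 1 := by
  rw [oneCocycles, oneCocycles,
    ← cancel_epi ((F.obj G).isoHomologyπ 0 1 (by simp) (hF G)).hom]
  simp

theorem oneToTot_totMap (hF : ∀ G, (F.obj G).d 0 1 = 0) (hF' : ∀ G, (F'.obj G).d 0 1 = 0)
    (X : SimplicialObject LenGrp) :
    oneToTot hF X ≫ totMap τ X =
      shiftedMap (Functor.whiskerRight τ (HomologicalComplex.homologyFunctor _ _ 1)) X ≫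
        oneToTot hF' X := by
  ext n : 1
  cases n with
  | zero =>
    exact (Limits.zero_comp (X := ModuleCat.of ℚ PUnit)).trans
      (Limits.comp_zero (X := ModuleCat.of ℚ PUnit) (f := 𝟙 _)).symm
  | succ n =>
    have h : oneCochain hF X n ≫ totMapApp τ X n 1 =
        (shiftedMap (Functor.whiskerRight τ (HomologicalComplex.homologyFunctor _ _ 1)) X).f
          (n + 1) ≫ oneCochain hF' X n :=
      (homologyMap_oneCocycles τ hF hF' (op (X _⦋n⦌))).symm
    change (oneCochain hF X n ≫ inTot F X n 1 (n + 1) rfl) ≫ (totMap τ X).f (n + 1) =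
      (shiftedMap _ X).f (n + 1) ≫ oneCochain hF' X n ≫ inTot F' X n 1 (n + 1) rfl
    rw [Category.assoc, inTot_totMap, ← Category.assoc, h, Category.assoc]

end Naturality

/-! ### The p-bounded contraction of the augmented simplicial set -/

section Contraction

theorem PolyBounded.mul {S : Type} {v : S → ℕ} {G : LenGrp} {f g : S → G}
    (hf : PolyBounded v G.len f) (hg : PolyBounded v G.len g) :
    PolyBounded v G.len fun s => f s * g s := by
  obtain ⟨C, k, hC⟩ := hf
  obtain ⟨D, l, hD⟩ := hg
  refine ⟨C + D, k + l, fun s => (G.len_mul_le _ _).trans ?_⟩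
  have h1 : (1 + v s) ^ k ≤ (1 + v s) ^ (k + l) := Nat.pow_le_pow_right (by omega) (by omega)
  have h2 : (1 + v s) ^ l ≤ (1 + v s) ^ (k + l) := Nat.pow_le_pow_right (by omega) (by omega)
  rw [add_mul]
  exact add_le_add ((hC s).trans (Nat.mul_le_mul_left _ h1))
    ((hD s).trans (Nat.mul_le_mul_left _ h2))

theorem PolyBounded.inv {S : Type} {v : S → ℕ} {G : LenGrp} {f : S → G}
    (hf : PolyBounded v G.len f) : PolyBounded v G.len fun s => (f s)⁻¹ := by
  obtain ⟨C, k, hC⟩ := hf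
  exact ⟨C, k, fun s => by rw [G.len_inv]; exact hC s⟩

theorem polyBounded_id {S : Type} (v : S → ℕ) : PolyBounded v v fun s => s :=
  ⟨1, 1, fun s => by simp⟩

theorem polyBounded_const {S T : Type} (v : S → ℕ) (w : T → ℕ) (t : T) :
    PolyBounded v w fun _ => t :=
  ⟨w t, 0, fun s => by simp⟩

theorem PolyBounded.tuple {G H : LenGrp} {φ : G → H} (hφ : PolyBounded G.len H.len φ) (n : ℕ) :
    PolyBounded (tupleLen G n) (tupleLen H n) fun g => φ ∘ g := by
  obtain ⟨C, k, h⟩ := hφ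
  refine ⟨n * C, k, fun g => ?_⟩
  have hi : ∀ i ∈ Finset.univ, H.len ((φ ∘ g) i) ≤ C * (1 + tupleLen G n g) ^ k := by
    intro i _
    refine (h (g i)).trans (Nat.mul_le_mul_left _ (Nat.pow_le_pow_left ?_ k))
    exact Nat.add_le_add_left
      (Finset.single_le_sum (f := fun i => G.len (g i)) (fun _ _ => Nat.zero_le _)
        (Finset.mem_univ i)) 1
  refine (Finset.sum_le_card_nsmul _ _ _ hi).trans ?_
  simp [mul_assoc]

variable (Γ : SimplicialObject.Augmented LenGrp)

/-- A p-bounded simplicial contraction of `Γ` onto `Γ_{-1}`, as simplicial sets. -/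
structure AugmentedContraction where
  /-- The section of the augmentation. -/
  sec : Γ.right → Γ.left _⦋0⦌
  /-- The extra degeneracies. -/
  h : ∀ n, Γ.left _⦋n⦌ → Γ.left _⦋n + 1⦌
  aug_sec : ∀ g, homOf (aug Γ 0) (sec g) = g
  face_zero : ∀ x, homOf (Γ.left.δ 0) (h 0 x) = sec (homOf (aug Γ 0) x)
  face_last : ∀ n x, homOf (Γ.left.δ (Fin.last (n + 1))) (h n x) = x
  face_castSucc : ∀ n (i : Fin (n + 2)) x,
    homOf (Γ.left.δ i.castSucc) (h (n + 1) x) = h n (homOf (Γ.left.δ i) x)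
  polyBounded_sec : PolyBounded (Γ.right).len (Γ.left _⦋0⦌).len sec
  polyBounded : ∀ n, PolyBounded (Γ.left _⦋n⦌).len (Γ.left _⦋n + 1⦌).len (h n)

/-- The iterated degeneracy `Γ_0 ⟶ Γ_n`. -/
def iterDegen (n : ℕ) : Γ.left _⦋0⦌ ⟶ Γ.left _⦋n⦌ :=
  Γ.left.map (SimplexCategory.isTerminalZero.from ⦋n⦌).op

theorem iterDegen_δ (n : ℕ) (i : Fin (n + 2)) :
    iterDegen Γ (n + 1) ≫ Γ.left.δ i = iterDegen Γ n := by
  refine (Γ.left.map_comp _ _).symm.trans (congrArg (fun f => Γ.left.map (Quiver.Hom.op f)) ?_)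
  exact SimplexCategory.isTerminalZero.hom_ext _ _

theorem iterDegen_aug (n : ℕ) : iterDegen Γ n ≫ aug Γ n = aug Γ 0 :=
  (Γ.hom.naturality (SimplexCategory.isTerminalZero.from ⦋n⦌).op).trans (Category.comp_id _)

theorem homOf_comp_apply {G H K : LenGrp} (f : G ⟶ H) (g : H ⟶ K) (x : G) :
    homOf (f ≫ g) x = homOf g (homOf f x) := rfl

/-- The maps `τ` commute with faces and faces are homomorphisms, so the factorization `x = τ(εx) ·
r(x)` is compatible with faces and the kernel's contraction can act on `r(x)` alone. -/
theorem IsTypeP.nonempty_augmentedContraction {Γ : SimplicialObject.Augmented LenGrp}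
    (hΓ : IsTypeP Γ) : Nonempty (AugmentedContraction Γ) := by
  obtain ⟨c⟩ := hΓ.contraction
  -- A lift of minimal length has the same length as the element lifted, so the section is
  -- p-bounded.
  choose σ hσ hσl using fun g => (hΓ.induced g).1
  have hσb : PolyBounded (Γ.right).len (Γ.left _⦋0⦌).len σ := ⟨1, 1, fun g => by rw [hσl, pow_one]; omega⟩
  let τ : ∀ n, Γ.right → Γ.left _⦋n⦌ := fun n g => homOf (iterDegen Γ n) (σ g)
  have hτb : ∀ n, PolyBounded (Γ.right).len (Γ.left _⦋n⦌).len (τ n) := fun n =>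
    (iterDegen Γ n).polyBounded.comp hσb
  have hτδ : ∀ n (i : Fin (n + 2)) g, homOf (Γ.left.δ i) (τ (n + 1) g) = τ n g := fun n i g => by
    rw [← homOf_comp_apply, iterDegen_δ]
  have hτε : ∀ n g, homOf (aug Γ n) (τ n g) = g := fun n g => by
    rw [← homOf_comp_apply, iterDegen_aug, hσ]
  let r : ∀ n, Γ.left _⦋n⦌ → augKer Γ n := fun n x =>
    ⟨(τ n (homOf (aug Γ n) x))⁻¹ * x, by
      rw [MonoidHom.mem_ker, map_mul, map_inv, hτε, inv_mul_cancel]⟩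
  have hτεb : ∀ m n, PolyBounded (Γ.left _⦋n⦌).len (Γ.left _⦋m⦌).len
      fun x => τ m (homOf (aug Γ n) x) := fun m n => (hτb m).comp (aug Γ n).polyBounded
  have hδε : ∀ n (i : Fin (n + 2)) x,
      homOf (aug Γ n) (homOf (Γ.left.δ i) x) = homOf (aug Γ (n + 1)) x := fun n i x => by
    rw [← homOf_comp_apply, δ_aug]
  have hr : ∀ n (i : Fin (n + 2)) x,
      kerFace Γ n i (r (n + 1) x) = r n (homOf (Γ.left.δ i) x) := fun n i x => by
    apply Subtype.ext
    change homOf (Γ.left.δ i) ((τ (n + 1) (homOf (aug Γ (n + 1)) x))⁻¹ * x) =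
      (τ n (homOf (aug Γ n) (homOf (Γ.left.δ i) x)))⁻¹ * homOf (Γ.left.δ i) x
    rw [map_mul, map_inv, hτδ, hδε]
  have hs : ∀ n (i : Fin (n + 2)) (y : augKer Γ (n + 1)),
      homOf (Γ.left.δ i) (y : Γ.left _⦋n + 1⦌) = kerFace Γ n i y := fun _ _ _ => rfl
  exact ⟨{
    sec := fun g => τ 0 g * c.base
    h := fun n x => τ (n + 1) (homOf (aug Γ n) x) * c.s n (r n x)
    aug_sec := fun g => by
      have hb : homOf (aug Γ 0) (c.base : Γ.left _⦋0⦌) = 1 := c.base.2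
      rw [map_mul, hτε, hb, mul_one]
    face_zero := fun x => by rw [map_mul, hτδ, hs, c.face_zero]
    face_last := fun n x => by
      rw [map_mul, hτδ, hs, c.face_last]
      exact mul_inv_cancel_left _ _
    face_castSucc := fun n i x => by
      rw [map_mul, hτδ, hs, c.face_castSucc, hr, hδε]
    polyBounded_sec := (hτb 0).mul (polyBounded_const _ _ _)
    polyBounded := fun n => (hτεb (n + 1) n).mul
      ((c.polyBounded n).comp (f := r n) ((hτεb n n).inv.mul (polyBounded_id _))) }⟩

end Contraction

/-! ### Models of cochains as functions on tuples -/

/-- A presentation of a functor of cochains as a functor of spaces of functions on tuples, closed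
under pull-back along p-bounded maps of sets and under the homotopy of a free group with
word-length metric. -/
structure CochainModel (F : LenGrpᵒᵖ ⥤ CochainComplex (ModuleCat.{0} ℚ) ℕ) where
  /-- The function underlying a cochain. -/
  val : ∀ (G : LenGrp) (p : ℕ), (F.obj (op G)).X p →ₗ[ℚ] ((Fin p → G) → ℚ)
  val_injective : ∀ G p, Function.Injective (val G p)
  val_d : ∀ G p x, val G (p + 1) (((F.obj (op G)).d p (p + 1)).hom x) = coboundary G p (val G p x)
  val_map : ∀ {G H : LenGrp} (f : G ⟶ H) (p : ℕ) (x : (F.obj (op H)).X p),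
    val G p (((F.map f.op).f p).hom x) = fun g => val H p x (homOf f ∘ g)
  exists_comp : ∀ {G H : LenGrp} (p : ℕ) (x : (F.obj (op H)).X p) (φ : G → H)
    (_ : PolyBounded G.len H.len φ), ∃ y, val G p y = fun g => val H p x (φ ∘ g)
  exists_freeHomotopy : ∀ (G : LenGrp) {S : Type} (b : FreeGroupBasis S G) (l : S → ℕ),
    (∀ s, 0 < l s) → (∀ g : G, G.len g =
      ((@FreeGroup.toWord S (Classical.decEq S) (b.repr g)).map fun x => l x.1).sum) →
    ∀ (m : ℕ) (x : (F.obj (op G)).X (m + 2)),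
      ∃ y, val G (m + 1) y = freeHomotopy b (val G (m + 2) x)

/-- The model of ordinary cochains. -/
def cochainsModel : CochainModel cochains where
  val _ _ := LinearMap.id
  val_injective _ _ := Function.injective_id
  val_d G p x := congrArg (fun φ => φ.hom x)
    (groupCohomology.inhomogeneousCochains.d_def (triv G) p)
  val_map _ _ _ := rfl
  exists_comp _ x φ _ := ⟨fun g => x (φ ∘ g), rfl⟩
  exists_freeHomotopy _ _ b _ _ _ _ x := ⟨freeHomotopy b x, rfl⟩

/-- The model of cochains of polynomial growth. -/
def polyCochainsModel : CochainModel polyCochainsFunctor where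
  val G p := (polyCochains G p).subtype
  val_injective _ _ := Subtype.val_injective
  val_d G p x := congrArg (fun φ => (φ.hom x).1) (CochainComplex.of_d
    (fun n => ModuleCat.of ℚ (polyCochains G n)) (fun n => ModuleCat.ofHom (polyD G n)) p)
  val_map _ _ _ := rfl
  exists_comp p x _ hφ := ⟨⟨_, polyCochains_of_le x.2 _ (hφ.tuple p)⟩, rfl⟩
  exists_freeHomotopy G _ b l hl hlen _ x :=
    ⟨⟨_, freeHomotopy_mem_polyCochains G b l hl hlen x.2⟩, rfl⟩

namespace CochainModel

variable {F : LenGrpᵒᵖ ⥤ CochainComplex (ModuleCat.{0} ℚ) ℕ}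

theorem sum_zsmul_hom_apply {A B : ModuleCat.{0} ℚ} {n : ℕ} (a : Fin n → ℤ) (f : Fin n → (A ⟶ B))
    (x : A) : (∑ i, a i • f i).hom x = ∑ i, a i • (f i).hom x := by
  simp [ModuleCat.hom_sum]

theorem val_face (M : CochainModel F) (X : SimplicialObject LenGrp) (q p : ℕ) (x : (F.obj (op (X _⦋q⦌))).X p)
    (g : Fin p → X _⦋q + 1⦌) :
    M.val (X _⦋q + 1⦌) p ((((bicomplex F X).d q (q + 1)).f p).hom x) g =
      ∑ i : Fin (q + 2), (-1 : ℚ) ^ (i : ℕ) * M.val (X _⦋q⦌) p x (homOf (X.δ i) ∘ g) := by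
  have h2 : ((bicomplex F X).d q (q + 1)).f p =
      ∑ i : Fin (q + 2), (-1 : ℤ) ^ (i : ℕ) • (F.map (X.δ i).op).f p := by
    rw [bicomplex_d]
    exact (map_sum
      (HomologicalComplex.eval (ModuleCat ℚ) (ComplexShape.up ℕ) p).mapAddHom _ _).trans
      (Finset.sum_congr rfl fun i _ => map_zsmul _ _ _)
  have h3 : ((((bicomplex F X).d q (q + 1)).f p).hom x : (F.obj (op (X _⦋q + 1⦌))).X p) =
      ∑ i : Fin (q + 2), (-1 : ℤ) ^ (i : ℕ) • ((F.map (X.δ i).op).f p).hom x :=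
    (congrArg (fun φ => φ.hom x) h2).trans (sum_zsmul_hom_apply _ _ _)
  refine (congrFun ((congrArg (M.val (X _⦋q + 1⦌) p) h3).trans (map_sum _ _ _)) g).trans ?_
  rw [Finset.sum_apply]
  refine Finset.sum_congr rfl fun i _ => ?_
  rw [map_zsmul, M.val_map]
  simp

theorem sum_val_eq_zero (M : CochainModel F) (X : SimplicialObject LenGrp) (q p : ℕ)
    (x : (F.obj (op (X _⦋q⦌))).X p) (hx : (((bicomplex F X).d q (q + 1)).f p).hom x = 0)
    (g : Fin p → X _⦋q + 1⦌) :
    ∑ i : Fin (q + 2), (-1 : ℚ) ^ (i : ℕ) * M.val (X _⦋q⦌) p x (homOf (X.δ i) ∘ g) = 0 := by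
  refine (M.val_face X q p x g).symm.trans ?_
  refine (congrArg (fun z => M.val (X _⦋q + 1⦌) p z g) hx).trans ?_
  exact congrFun (map_zero (M.val (X _⦋q + 1⦌) p)) g

theorem exactRows (M : CochainModel F) {Γ : SimplicialObject.Augmented LenGrp}
    (c : AugmentedContraction Γ) :
    ExactRows F Γ where
  injective p x y hxy := by
    refine M.val_injective _ _ (funext fun g => ?_)
    have h := congrArg (fun z => M.val (Γ.left _⦋0⦌) p z (c.sec ∘ g)) hxy
    have hv : ∀ z, M.val (Γ.left _⦋0⦌) p ((augCochain F Γ p).hom z) (c.sec ∘ g) =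
        M.val Γ.right p z (homOf (aug Γ 0) ∘ c.sec ∘ g) := fun z =>
      congrFun (M.val_map (aug Γ 0) p z) _
    have hg : homOf (aug Γ 0) ∘ c.sec ∘ g = g := funext fun i => c.aug_sec _
    simp only [hv, hg] at h
    exact h
  exact_zero p (x : (F.obj (op (Γ.left _⦋0⦌))).X p) hx := by
    -- Evaluating the vanishing coboundary on `h g` says that `x` agrees on `g` and `sec (ε g)`, so
    -- `x` is the pull-back of `x ∘ sec`.
    obtain ⟨y, hy⟩ := M.exists_comp p x c.sec c.polyBounded_sec
    refine ⟨y, M.val_injective (Γ.left _⦋0⦌) p (funext fun g => ?_)⟩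
    have h := (Fin.sum_univ_two _).symm.trans (M.sum_val_eq_zero Γ.left 0 p x hx (c.h 0 ∘ g))
    simp only [Fin.val_zero, Fin.val_one, pow_zero, pow_one, one_mul,
      neg_mul] at h
    have h0 : homOf (Γ.left.δ (n := 0) 0) ∘ c.h 0 ∘ g = c.sec ∘ homOf (aug Γ 0) ∘ g :=
      funext fun i => c.face_zero _
    have h1 : homOf (Γ.left.δ (n := 0) 1) ∘ c.h 0 ∘ g = g := funext fun i => c.face_last 0 _
    rw [h0, h1] at h
    refine (congrFun (M.val_map (aug Γ 0) p y) g).trans ?_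
    refine (congrFun hy _).trans ?_
    linarith
  exact_succ q p (x : (F.obj (op (Γ.left _⦋q + 1⦌))).X p) hx := by
    obtain ⟨y, hy⟩ := M.exists_comp p x (c.h q) (c.polyBounded q)
    -- The extra degeneracy is the last one: the face of index `q + 2` returns `x g` with sign `(-1)
    -- ^ (q + 2)`, and the remaining faces sum to its negative.
    refine ⟨((-1 : ℚ) ^ (q + 1)) • y, M.val_injective (Γ.left _⦋q + 1⦌) p (funext fun g => ?_)⟩
    have h := M.sum_val_eq_zero Γ.left (q + 1) p x hx (c.h (q + 1) ∘ g)
    rw [Fin.sum_univ_castSucc] at h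
    have hl : homOf (Γ.left.δ (Fin.last (q + 2))) ∘ c.h (q + 1) ∘ g = g :=
      funext fun i => c.face_last (q + 1) _
    have hi : ∀ i : Fin (q + 2), homOf (Γ.left.δ i.castSucc) ∘ c.h (q + 1) ∘ g =
        c.h q ∘ homOf (Γ.left.δ i) ∘ g := fun i => funext fun j => c.face_castSucc q i _
    have hv : ∀ z, M.val (Γ.left _⦋q⦌) p ((-1 : ℚ) ^ (q + 1) • y) z =
        (-1 : ℚ) ^ (q + 1) * M.val (Γ.left _⦋q + 1⦌) p x (c.h q ∘ z) := fun z =>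
      (congrFun (map_smul (M.val (Γ.left _⦋q⦌) p) ((-1 : ℚ) ^ (q + 1)) y) z).trans
        (congrArg _ (congrFun hy z))
    refine (M.val_face Γ.left q p ((-1 : ℚ) ^ (q + 1) • y) g).trans ?_
    simp only [hv]
    simp only [hi, Fin.val_castSucc, Fin.val_last] at h
    rw [hl] at h
    have hs : ∑ i : Fin (q + 2), (-1 : ℚ) ^ (i : ℕ) *
        ((-1 : ℚ) ^ (q + 1) * M.val (Γ.left _⦋q + 1⦌) p x (c.h q ∘ homOf (Γ.left.δ i) ∘ g)) =
        (-1 : ℚ) ^ (q + 1) * ∑ i : Fin (q + 2), (-1 : ℚ) ^ (i : ℕ) *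
          M.val (Γ.left _⦋q + 1⦌) p x (c.h q ∘ homOf (Γ.left.δ i) ∘ g) := by
      rw [Finset.mul_sum]
      exact Finset.sum_congr rfl fun i _ => by ring
    rw [hs, eq_neg_of_add_eq_zero_left h]
    have hu : (-1 : ℚ) ^ (q + 1) * (-1 : ℚ) ^ (q + 1) = 1 := by rw [← mul_pow]; simp
    rw [pow_succ (-1 : ℚ) (q + 1)]
    linear_combination M.val (Γ.left _⦋q + 1⦌) p x g * hu

theorem exactColumns (M : CochainModel F) {Γ : SimplicialObject.Augmented LenGrp} (hΓ : IsTypeP Γ) :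
    ExactColumns F Γ.left where
  exact q p x hx := by
    obtain ⟨S, b, l, hl, hlen⟩ := hΓ.metric q
    obtain ⟨y, hy⟩ := M.exists_freeHomotopy _ b l hl hlen p x
    refine ⟨y, M.val_injective (Γ.left _⦋q⦌) (p + 2) ?_⟩
    refine (M.val_d _ _ y).trans ?_
    rw [hy]
    refine coboundary_freeHomotopy b _ ?_
    refine (M.val_d _ _ x).symm.trans ?_
    refine (congrArg (M.val (Γ.left _⦋q⦌) (p + 3)) hx).trans (map_zero _)
  exact_bottom q x hx := by
    obtain ⟨c⟩ := hΓ.nonempty_augmentedContraction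
    -- The bottom row is the row `p = 0`.
    exact (M.exactRows c).exact_succ q 0 x hx

end CochainModel

/-! ### Injectivity in degree one and assembly of the isomorphisms -/

/-- Both first cohomology groups embed in `1`-cochains, where the comparison map becomes the
inclusion of cochains of polynomial growth. -/
theorem inclDE_f_injective (X : SimplicialObject LenGrp) (n : ℕ) :
    Function.Injective ((inclDE X).f n).hom := by
  cases n with
  | zero => exact Function.injective_id
  | succ n =>
    have h : ∀ e, (oneCochain cochains_d_zero X n).hom (((inclDE X).f (n + 1)).hom e) =
        (totMapApp polyInclNat X n 1).hom ((oneCochain polyCochains_d_zero X n).hom e) := fun e =>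
      congrArg (fun φ => φ.hom e)
        (homologyMap_oneCocycles polyInclNat polyCochains_d_zero cochains_d_zero (op (X _⦋n⦌)))
    have hi : Function.Injective (totMapApp polyInclNat X n 1).hom := Subtype.val_injective
    intro x y hxy
    refine oneCochain_injective polyCochains_d_zero X n (hi ?_)
    rw [← h, hxy, h]

end PBd

end

theorem theoremA12 (Γ : SimplicialObject.Augmented PBd.LenGrp) (hΓ : PBd.IsTypeP Γ) :
    (∀ n : ℕ, Function.Injective ((PBd.inclDE Γ.left).f n).hom) ∧
    ∀ n : ℕ, 1 ≤ n →
      ∃ (a : (PBd.PH n).obj (op Γ.right) ≅ (PBd.D Γ.left).homology n)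
        (b : (PBd.H n).obj (op Γ.right) ≅ (PBd.E Γ.left).homology n),
        a.hom ≫ HomologicalComplex.homologyMap (PBd.inclDE Γ.left) n =
            (PBd.comparison n).app (op Γ.right) ≫ b.hom ∧
          (IsIso (HomologicalComplex.homologyMap (PBd.DToTot Γ.left) n) ∧
            a.hom ≫ HomologicalComplex.homologyMap (PBd.DToTot Γ.left) n =
              HomologicalComplex.homologyMap (PBd.augToTot PBd.polyCochainsFunctor Γ) n) ∧
          (IsIso (HomologicalComplex.homologyMap (PBd.EToTot Γ.left) n) ∧
            b.hom ≫ HomologicalComplex.homologyMap (PBd.EToTot Γ.left) n =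
              HomologicalComplex.homologyMap (PBd.augToTot PBd.cochains Γ) n) := by
  refine ⟨PBd.inclDE_f_injective Γ.left, fun n hn => ?_⟩
  obtain ⟨n, rfl⟩ : ∃ k, n = k + 1 := ⟨n - 1, by omega⟩
  obtain ⟨c⟩ := hΓ.nonempty_augmentedContraction
  have iP : IsIso (HomologicalComplex.homologyMap (PBd.augToTot PBd.polyCochainsFunctor Γ) (n + 1)) :=
    (PBd.polyCochainsModel.exactRows c).isIso_homologyMap_augToTot _
  have iC : IsIso (HomologicalComplex.homologyMap (PBd.augToTot PBd.cochains Γ) (n + 1)) :=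
    (PBd.cochainsModel.exactRows c).isIso_homologyMap_augToTot _
  have iD : IsIso (HomologicalComplex.homologyMap (PBd.DToTot Γ.left) (n + 1)) :=
    (PBd.polyCochainsModel.exactColumns hΓ).isIso_homologyMap_oneToTot _ _
  have iE : IsIso (HomologicalComplex.homologyMap (PBd.EToTot Γ.left) (n + 1)) :=
    (PBd.cochainsModel.exactColumns hΓ).isIso_homologyMap_oneToTot _ _
  let a := asIso (HomologicalComplex.homologyMap (PBd.augToTot PBd.polyCochainsFunctor Γ) (n + 1)) ≪≫
    (asIso (HomologicalComplex.homologyMap (PBd.DToTot Γ.left) (n + 1))).symm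
  let b := asIso (HomologicalComplex.homologyMap (PBd.augToTot PBd.cochains Γ) (n + 1)) ≪≫
    (asIso (HomologicalComplex.homologyMap (PBd.EToTot Γ.left) (n + 1))).symm
  have ha : a.hom ≫ HomologicalComplex.homologyMap (PBd.DToTot Γ.left) (n + 1) =
      HomologicalComplex.homologyMap (PBd.augToTot PBd.polyCochainsFunctor Γ) (n + 1) := by simp [a]
  have hb : b.hom ≫ HomologicalComplex.homologyMap (PBd.EToTot Γ.left) (n + 1) =
      HomologicalComplex.homologyMap (PBd.augToTot PBd.cochains Γ) (n + 1) := by simp [b]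
  have h1 : PBd.DToTot Γ.left ≫ PBd.totMap PBd.polyInclNat Γ.left =
      PBd.inclDE Γ.left ≫ PBd.EToTot Γ.left :=
    PBd.oneToTot_totMap _ PBd.polyCochains_d_zero PBd.cochains_d_zero _
  have h2 := PBd.augToTot_totMap PBd.polyInclNat Γ
  have hab : a.hom ≫ HomologicalComplex.homologyMap (PBd.inclDE Γ.left) (n + 1) =
      HomologicalComplex.homologyMap (PBd.polyInclNat.app (op Γ.right)) (n + 1) ≫ b.hom := by
    -- After composing with the isomorphism to the total complex of ordinary cochains, both sides
    -- become pull-back along `ε` combined with the inclusion of coefficient functors.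
    rw [← cancel_mono (HomologicalComplex.homologyMap (PBd.EToTot Γ.left) (n + 1)),
      Category.assoc, Category.assoc, hb, ← HomologicalComplex.homologyMap_comp, ← h1,
      HomologicalComplex.homologyMap_comp, ← Category.assoc, ha,
      ← HomologicalComplex.homologyMap_comp, h2, HomologicalComplex.homologyMap_comp]
  exact ⟨a, b, hab, ⟨iD, ha⟩, iE, hb⟩
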